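/- Let $\mathbb{H}$ be an infinite-dimensional real Hilbert space and $A_0$ a positive-definite self-adjoint operator in $\mathbb{H}$ with compact resolvent. Let $0<\lambda_1\le\lambda_2\le\dots$ be its eigenvalues and $e_1,e_2,\dots$ an associated orthonormal basis of eigenvectors. For $\beta\ge 0$ let $\mathbb{H}_\beta=\mathcal{D}(A_0^\beta)$ with $\langle v,w\rangle_\beta=\langle A_0^\beta v,A_0^\beta w\rangle_{\mathbb{H}}$, and $\breve{\mathbb{H}}_\beta=\mathbb{H}_\beta\times\mathbb{H}_\beta$. Let $k,N$ be positive integers and $\Lambda,\delta>0$ reals. Put $\alpha=(\lambda_N+\lambda_{N+1})/2$, $\bar\mu=(\lambda_{N+1}-\lambda_N)/2$, $A=-A_0+\alpha I$. Let $\mathcal{P}$ and $\mathcal{Q}^{\mathrm{h}}$ be the orthogonal projectors onto the closed spans of the $e_j$ with $\lambda_j<\lambda_N-k$ and with $\lambda_j>\lambda_{N+1}+k$ respectively, and $\mathcal{I}=\mathrm{Id}-\mathcal{P}-\mathcal{Q}^{\mathrm{h}}$. Let $(\mathcal{Q},\vartheta)$ be a semiflow on a complete metric space and $a\colon\mathcal{Q}\to\mathbb{R}$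 a continuous function with $\sup_{q}|a(q)|\le\Lambda+\delta$. Let $\tau_1=1$, $\tau_2=\bar\mu^2/(4\Lambda^2)$, $\tau_3=1$. For $v\in\mathbb{H}$ and $\xi=(\xi_I,\xi_c)\in\mathbb{U}=\mathbb{H}\times\mathbb{H}$ put $B\xi=\xi_I+\xi_c$ and $$F_1(q)v=(\tau_1a(q)^2-\tau_1\delta^2-\tau_2\Lambda^2)\,\mathcal{I}v-\tau_3\Lambda^2(\mathcal{P}+\mathcal{Q}^{\mathrm{h}})v,\quad F_2(q)v=(-\tau_1a(q)\mathcal{I}v,0),$$ $$F_3\xi=(\tau_1\mathcal{I}\xi_I+\tau_2(\mathcal{P}+\mathcal{Q}^{\mathrm{h}})\xi_I,\ \tau_3\xi_c).$$ Consider the Hamiltonian system $$\frac{d}{dt}\begin{pmatrix}v\\ \eta\end{pmatrix}=\begin{pmatrix}\widehat A(\vartheta^tq)&BF_3^{-1}B^*\\ F_1(\vartheta^tq)-F_2^*(\vartheta^tq)F_3^{-1}F_2(\vartheta^tq)&-\widehat A^*(\vartheta^tq)\end{pmatrix}\begin{pmatrix}v\\ \eta\end{pmatrix},\qquad \widehat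 A(q)=A-a(q)I-BF_3^{-1}F_2(q).\tag{1}$$ Its solutions are understood as mild solutions: the system is written as $\dot z=\mathrm{diag}(A,-A)z+R(\vartheta^tq)z$ with $R(q)$ bounded, and the Cauchy formula is used forward in time for $v$ and backward in time for $\eta$. The same system is considered in $\breve{\mathbb{H}}_\beta$ for every $\beta\ge0$. Let $\mathbb{L}^+_{b,\beta}(q)$ be the set of all $z_0\in\breve{\mathbb{H}}_\beta$ for which there is a bounded solution $z$ of (1) on $[0,\infty)$ in $\breve{\mathbb{H}}_\beta$ with $z(0)=z_0$. For $\varepsilon\in\mathbb{R}$ let $\mathbb{L}^+_{\varepsilon,\beta}(q)$ be the set of all $z_0$ for which there is a solution $z$ with $z(0)=z_0$ and $e^{\varepsilon t}z(t)\in L_2(0,\infty;\breve{\mathbb{H}}_\beta)$. Let $\breve{\mathbb{H}}^s_\beta$ (resp. $\breve{\mathbb{H}}^u_\beta$) consist of all $(v,\eta)\in\breve{\mathbb{H}}_\beta$ such that $v$ (resp. $\eta$) lies in the closed span of $e_{N+1},e_{N+2},\dots$ and $\eta$ (resp. $v$) lies in the span of $e_1,\dots,e_N$. A subspace $\mathbb{L}\subset\breve{\mathbb{H}}_\beta$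 is Lagrange if $J\mathbb{L}=\mathbb{L}^\perp$, where $J(v,\eta)=(-\eta,v)$. **Theorem.** Suppose that $$\frac{\bar\mu}{\sqrt5}-\delta\ge0\quad\text{and}\quad k^2-2\Lambda k-4\frac{\Lambda^4}{\bar\mu^2}\ge0.$$ Then: 1. For every $q\in\mathcal{Q}$ and $\beta\ge0$, $\mathbb{L}^+_{b,\beta}(q)$ is a Lagrange subspace of $\breve{\mathbb{H}}_\beta$. 2. There is $\varepsilon_0>0$, independent of $q$ and $\beta$, such that $\mathbb{L}^+_{b,\beta}(q)=\mathbb{L}^+_{\varepsilon,\beta}(q)$ for all $q\in\mathcal{Q}$, $\beta\ge0$ and $|\varepsilon|\le\varepsilon_0$. Moreover, for every $0<\varepsilon\le\varepsilon_0$ there is $M_\varepsilon>0$ such that for all $q\in\mathcal{Q}$, $\beta\ge0$, $z_0\in\mathbb{L}^+_{b,\beta}(q)$ and every solution $z$ of (1) in $\breve{\mathbb{H}}_\beta$ with $z(0)=z_0$, $$|z(t)|_{\breve{\mathbb{H}}_\beta}\le M_\varepsilon e^{-\varepsilon t}|z_0|_{\breve{\mathbb{H}}_\beta}\quad\text{for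 all }t\ge0.$$ 3. There are bounded linear operators $M^+_\beta(q)\colon\breve{\mathbb{H}}^s_\beta\to\breve{\mathbb{H}}^u_\beta$ with $$\mathbb{L}^+_{b,\beta}(q)=\{z^s+M^+_\beta(q)z^s\mid z^s\in\breve{\mathbb{H}}^s_\beta\},$$ whose norms are bounded uniformly in $q\in\mathcal{Q}$ and $\beta\ge0$, and for every $\beta\ge0$ the map $q\mapsto M^+_\beta(q)$ is continuous in the operator norm. -/

import Mathlib

open scoped NNReal InnerProductSpace
open MeasureTheory

namespace SpatAvrg

noncomputable section

section Operator

variable {H : Type*} [NormedAddCommGroup H] [InnerProductSpace ℝ H]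

/-- The operator `A` has compact resolvent if, for some real `ζ`,
`A - ζ` is a bijection from its domain onto the space with compact inverse `K`. -/
def HasCompactResolvent (A : H →ₗ.[ℝ] H) : Prop :=
  ∃ (ζ : ℝ) (K : H →L[ℝ] H), IsCompactOperator K ∧
    (∀ x : H, ∃ h : K x ∈ A.domain, A ⟨K x, h⟩ - ζ • K x = x) ∧
    (∀ v : A.domain, K (A v - ζ • (v : H)) = v)

end Operator

/-- A positive-definite self-adjoint operator `A₀` with compact resolvent in a real Hilbert space,
together with its eigenvalues `lam 1 ≤ lam 2 ≤ …` (repeated according to multiplicity) and an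
associated orthonormal basis of eigenvectors `e 1, e 2, …`. -/
structure SpectralData (H : Type*) [NormedAddCommGroup H] [InnerProductSpace ℝ H]
    [CompleteSpace H] where
  A₀ : H →ₗ.[ℝ] H
  selfAdjoint : IsSelfAdjoint A₀
  posDef : ∃ c : ℝ, 0 < c ∧ ∀ v : A₀.domain, c * ‖(v : H)‖ ^ 2 ≤ ⟪A₀ v, (v : H)⟫_ℝ
  compactResolvent : HasCompactResolvent A₀
  lam : ℕ+ → ℝ
  lam_mono : Monotone lam
  e : HilbertBasis ℕ+ ℝ H
  e_mem : ∀ j, e j ∈ A₀.domain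
  eigen : ∀ j, A₀ ⟨e j, e_mem j⟩ = lam j • e j

/-! ### The scale of spaces `H_β` -/

namespace SpectralData

variable {H : Type*} [NormedAddCommGroup H] [InnerProductSpace ℝ H] [CompleteSpace H]

theorem lam_pos (S : SpectralData H) (j : ℕ+) : 0 < S.lam j := by
  obtain ⟨c, hc, h⟩ := S.posDef
  have h1 := h ⟨S.e j, S.e_mem j⟩
  have h2 : ‖S.e j‖ = 1 := S.e.orthonormal.1 j
  rw [S.eigen, inner_smul_left, real_inner_self_eq_norm_sq] at h1
  simp only [h2] at h1
  norm_num at h1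
  linarith

/-- The domain of the fractional power `A₀ ^ β`: all `v` for which the sequence
`lam j ^ β * ⟪e j, v⟫` is square-summable. -/
def powDomain (S : SpectralData H) (β : ℝ≥0) : Submodule ℝ H where
  carrier := {v | Memℓp (fun j => S.lam j ^ (β : ℝ) * ⟪S.e j, v⟫_ℝ) 2}
  zero_mem' := by
    have : (fun j => S.lam j ^ (β : ℝ) * ⟪S.e j, (0 : H)⟫_ℝ) = 0 := by
      ext j; simp
    simpa only [Set.mem_ofPred_eq, this] using zero_memℓp
  add_mem' := by
    intro v w hv hw
    have : (fun j => S.lam j ^ (β : ℝ) * ⟪S.e j, v + w⟫_ℝ) =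
        (fun j => S.lam j ^ (β : ℝ) * ⟪S.e j, v⟫_ℝ) +
          (fun j => S.lam j ^ (β : ℝ) * ⟪S.e j, w⟫_ℝ) := by
      ext j; simp [inner_add_right, mul_add]
    simpa only [Set.mem_ofPred_eq, this] using Memℓp.add hv hw
  smul_mem' := by
    intro c v hv
    have : (fun j => S.lam j ^ (β : ℝ) * ⟪S.e j, c • v⟫_ℝ) =
        c • (fun j => S.lam j ^ (β : ℝ) * ⟪S.e j, v⟫_ℝ) := by
      ext j; simp [inner_smul_right]; ring
    simpa only [Set.mem_ofPred_eq, this] using Memℓp.const_smul hv c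

/-- The fractional power `A₀ ^ β v = ∑ j, lam j ^ β * ⟪e j, v⟫ • e j` on its domain. -/
def pow (S : SpectralData H) (β : ℝ≥0) : S.powDomain β →ₗ[ℝ] H where
  toFun v := S.e.repr.symm ⟨fun j => S.lam j ^ (β : ℝ) * ⟪S.e j, (v : H)⟫_ℝ, v.2⟩
  map_add' := by
    intro v w
    rw [← map_add]
    congr 1
    ext j
    change S.lam j ^ (β : ℝ) * ⟪S.e j, (v : H) + (w : H)⟫_ℝ =
      S.lam j ^ (β : ℝ) * ⟪S.e j, (v : H)⟫_ℝ + S.lam j ^ (β : ℝ) * ⟪S.e j, (w : H)⟫_ℝ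
    rw [inner_add_right, mul_add]
  map_smul' := by
    intro c v
    rw [RingHom.id_apply, ← map_smul]
    congr 1
    ext j
    simp [inner_smul_right]
    ring

theorem repr_pow (S : SpectralData H) (β : ℝ≥0) (v : S.powDomain β) (j : ℕ+) :
    S.e.repr (S.pow β v) j = S.lam j ^ (β : ℝ) * ⟪S.e j, (v : H)⟫_ℝ := by
  simp [pow]

theorem hasSum_pow (S : SpectralData H) (β : ℝ≥0) (v : S.powDomain β) :
    HasSum (fun j => (S.lam j ^ (β : ℝ) * ⟪S.e j, (v : H)⟫_ℝ) • S.e j) (S.pow β v) := by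
  simpa only [repr_pow] using S.e.hasSum_repr (S.pow β v)

theorem pow_injective (S : SpectralData H) (β : ℝ≥0) : Function.Injective (S.pow β) := by
  intro v w h
  apply Subtype.ext
  apply S.e.repr.injective
  ext j
  have h1 : S.e.repr (S.pow β v) j = S.e.repr (S.pow β w) j := by rw [h]
  rw [repr_pow, repr_pow] at h1
  have h2 := mul_left_cancel₀ (Real.rpow_pos_of_pos (S.lam_pos j) (β : ℝ)).ne' h1
  simpa only [S.e.repr_apply_apply] using h2

theorem pow_surjective (S : SpectralData H) (β : ℝ≥0) : Function.Surjective (S.pow β) := by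
  intro w
  have hmem : Memℓp (fun j => S.lam j ^ (-(β : ℝ)) * S.e.repr w j) 2 := by
    refine Memℓp.mono' (g := (S.lam 1 ^ (-(β : ℝ))) • (S.e.repr w : ℕ+ → ℝ))
      (Memℓp.const_smul (𝕜 := ℝ) (E := fun _ : ℕ+ => ℝ) (lp.memℓp (S.e.repr w)) _) ?_
    intro j
    have h1 : S.lam j ^ (-(β : ℝ)) ≤ S.lam 1 ^ (-(β : ℝ)) :=
      Real.rpow_le_rpow_of_nonpos (S.lam_pos 1) (S.lam_mono one_le)
        (neg_nonpos.2 β.2)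
    have h2 : 0 ≤ S.lam j ^ (-(β : ℝ)) := Real.rpow_nonneg (S.lam_pos j).le _
    simp only [Pi.smul_apply, smul_eq_mul, norm_mul, Real.norm_eq_abs, abs_of_nonneg h2,
      abs_of_nonneg (h2.trans h1)]
    gcongr
  have hcoord : ∀ j, ⟪S.e j, S.e.repr.symm ⟨_, hmem⟩⟫_ℝ
      = S.lam j ^ (-(β : ℝ)) * S.e.repr w j := by
    intro j
    rw [← S.e.repr_apply_apply]
    simp
  have hprod : ∀ j, S.lam j ^ (β : ℝ) * ⟪S.e j, S.e.repr.symm ⟨_, hmem⟩⟫_ℝ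
      = S.e.repr w j := by
    intro j
    rw [hcoord, ← mul_assoc, ← Real.rpow_add (S.lam_pos j)]
    simp
  refine ⟨⟨S.e.repr.symm ⟨_, hmem⟩, ?_⟩, ?_⟩
  · change Memℓp _ 2
    simp only [hprod]
    exact lp.memℓp (S.e.repr w)
  · apply S.e.repr.injective
    ext j
    rw [repr_pow]
    exact hprod j

/-- The space `H_β`: the domain of `A₀ ^ β` endowed with the inner product
`⟪v, w⟫_β = ⟪A₀ ^ β v, A₀ ^ β w⟫`. -/
def Scale (S : SpectralData H) (β : ℝ≥0) : Type _ := S.powDomain β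

instance (S : SpectralData H) (β : ℝ≥0) : AddCommGroup (S.Scale β) :=
  inferInstanceAs (AddCommGroup (S.powDomain β))

instance (S : SpectralData H) (β : ℝ≥0) : Module ℝ (S.Scale β) :=
  inferInstanceAs (Module ℝ (S.powDomain β))

/-- `A₀ ^ β` as a linear bijection from `H_β` onto `H`. -/
def scalePow (S : SpectralData H) (β : ℝ≥0) : S.Scale β ≃ₗ[ℝ] H :=
  LinearEquiv.ofBijective (S.pow β) ⟨S.pow_injective β, S.pow_surjective β⟩

instance (S : SpectralData H) (β : ℝ≥0) : NormedAddCommGroup (S.Scale β) :=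
  NormedAddCommGroup.induced (S.Scale β) H (S.scalePow β) (S.scalePow β).injective

theorem norm_scale (S : SpectralData H) (β : ℝ≥0) (v : S.Scale β) :
    ‖v‖ = ‖S.scalePow β v‖ := rfl

instance (S : SpectralData H) (β : ℝ≥0) : InnerProductSpace ℝ (S.Scale β) where
  inner v w := ⟪S.scalePow β v, S.scalePow β w⟫_ℝ
  norm_smul_le c v := by
    rw [norm_scale, norm_scale, map_smul, norm_smul]
  norm_sq_eq_re_inner v := by
    rw [norm_scale]; exact norm_sq_eq_re_inner (𝕜 := ℝ) (S.scalePow β v)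
  conj_inner_symm v w := inner_conj_symm (𝕜 := ℝ) (S.scalePow β v) (S.scalePow β w)
  add_left u v w := by
    change ⟪S.scalePow β (u + v), _⟫_ℝ = _
    rw [map_add, inner_add_left]
  smul_left v w c := by
    change ⟪S.scalePow β (c • v), _⟫_ℝ = _
    rw [map_smul, inner_smul_left]

/-- `A₀ ^ β` as an isometric isomorphism from `H_β` onto `H`. -/
def scaleIso (S : SpectralData H) (β : ℝ≥0) : S.Scale β ≃ₗᵢ[ℝ] H where
  toLinearEquiv := S.scalePow β
  norm_map' _ := rfl

instance (S : SpectralData H) (β : ℝ≥0) : CompleteSpace (S.Scale β) :=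
  (completeSpace_congr (S.scaleIso β).isometry.isUniformEmbedding
    (e := (S.scaleIso β).toEquiv)).2 inferInstance

/-- The orthonormal basis of `H_β` consisting of the eigenvectors `lam j ^ (-β) • e j`. -/
def scaleBasis (S : SpectralData H) (β : ℝ≥0) : HilbertBasis ℕ+ ℝ (S.Scale β) :=
  HilbertBasis.ofRepr ((S.scaleIso β).trans S.e.repr)

theorem scaleBasis_coe (S : SpectralData H) (β : ℝ≥0) (j : ℕ+) :
    ((show S.powDomain β from S.scaleBasis β j : S.powDomain β) : H)
      = S.lam j ^ (-(β : ℝ)) • S.e j := by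
  classical
  have h : S.scaleIso β (S.scaleBasis β j) = S.e j := by
    apply S.e.repr.injective
    have h1 : S.e.repr (S.scaleIso β (S.scaleBasis β j)) =
        (S.scaleBasis β).repr (S.scaleBasis β j) := rfl
    rw [h1, HilbertBasis.repr_self, HilbertBasis.repr_self]
  apply S.e.repr.injective
  ext i
  have h1 := S.repr_pow β (show S.powDomain β from S.scaleBasis β j) i
  have h2 : S.pow β (show S.powDomain β from S.scaleBasis β j) = S.e j := h
  rw [h2, ← S.e.repr_apply_apply] at h1
  have h3 := (Real.rpow_pos_of_pos (S.lam_pos i) (β : ℝ)).ne'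
  rw [map_smul, lp.coeFn_smul, Pi.smul_apply, h1, smul_eq_mul]
  rw [HilbertBasis.repr_self] at h1
  by_cases hij : i = j
  · subst hij
    rw [← mul_assoc, ← Real.rpow_add (S.lam_pos i)]
    simp
  · simp only [lp.single_apply_ne _ _ _ hij] at h1
    rcases mul_eq_zero.1 h1.symm with h0 | h0
    · exact absurd h0 h3
    · rw [h0]; simp

end SpectralData

/-! ### The Hamiltonian system

The constructions below are written for a real Hilbert space `X` with an orthonormal basis `f` of
eigenvectors belonging to the eigenvalues `lam`; they are applied with `X = H_β`. -/

/-- The constants of the problem. -/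
structure Params where
  k : ℕ+
  N : ℕ+
  Λ : ℝ
  δ : ℝ
  τ₁ : ℝ
  τ₂ : ℝ
  τ₃ : ℝ

/-- `α = (lam N + lam (N+1)) / 2`. -/
def Params.α (p : Params) (lam : ℕ+ → ℝ) : ℝ := (lam p.N + lam (p.N + 1)) / 2

/-- `μ̄ = (lam (N+1) - lam N) / 2`. -/
def Params.μ (p : Params) (lam : ℕ+ → ℝ) : ℝ := (lam (p.N + 1) - lam p.N) / 2

/-- The space `X × X` with the Hilbert space (that is, `ℓ²`) product norm. -/
abbrev Double (X : Type*) : Type _ := WithLp 2 (X × X)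

section Hamiltonian

variable {X : Type*} [NormedAddCommGroup X] [InnerProductSpace ℝ X]

/-- The continuous linear map `z ↦ (S z, T z)` into `X × X`. -/
def pairing {Y : Type*} [NormedAddCommGroup Y] [InnerProductSpace ℝ Y] (S T : Y →L[ℝ] X) :
    Y →L[ℝ] Double X :=
  ((WithLp.prodContinuousLinearEquiv 2 ℝ X X).symm : X × X →L[ℝ] Double X) ∘L (S.prod T)

/-- The projection `(v, η) ↦ v`. -/
def fstD : Double X →L[ℝ] X := WithLp.fstL 2 ℝ X X

/-- The projection `(v, η) ↦ η`. -/
def sndD : Double X →L[ℝ] X := WithLp.sndL 2 ℝ X X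

/-- The complex structure `J (v, η) = (-η, v)`. -/
def J : Double X →L[ℝ] Double X := pairing (-sndD) fstD

/-- A set `L ⊆ X × X` is a Lagrange subspace if it is a linear subspace with `J L = Lᗮ`. -/
def IsLagrange (L : Set (Double X)) : Prop :=
  ∃ V : Submodule ℝ (Double X), (V : Set (Double X)) = L ∧
    V.map (J : Double X →L[ℝ] Double X).toLinearMap = Vᗮ

/-- The closed linear span of the basis vectors `f j`, `j ∈ s`. -/
def spectralSpace (f : HilbertBasis ℕ+ ℝ X) (s : Set ℕ+) : Submodule ℝ X :=
  (Submodule.span ℝ (f '' s)).topologicalClosure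

/-- The stable subspace `X^s × X^u` of `(v, η) ↦ (A v, -A η)`, where `A = α - A₀`, the space `X^u`
is spanned by `f 1, …, f N` and `X^s` by the remaining basis vectors. -/
def stableSpace (f : HilbertBasis ℕ+ ℝ X) (p : Params) : Submodule ℝ (Double X) :=
  (spectralSpace f {j | p.N < j}).comap (fstD (X := X)).toLinearMap ⊓
    (spectralSpace f {j | j ≤ p.N}).comap (sndD (X := X)).toLinearMap

/-- The unstable subspace `X^u × X^s` of `(v, η) ↦ (A v, -A η)`. -/
def unstableSpace (f : HilbertBasis ℕ+ ℝ X) (p : Params) : Submodule ℝ (Double X) :=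
  (spectralSpace f {j | j ≤ p.N}).comap (fstD (X := X)).toLinearMap ⊓
    (spectralSpace f {j | p.N < j}).comap (sndD (X := X)).toLinearMap

/-- The `C₀`-semigroup `exp (t A)`, `t ≥ 0`, generated by the self-adjoint operator
`A = α - A₀`, given by its spectral expansion. -/
def semigroup (f : HilbertBasis ℕ+ ℝ X) (lam : ℕ+ → ℝ) (p : Params) (t : ℝ) (v : X) : X :=
  ∑' j, (Real.exp (t * (p.α lam - lam j)) * ⟪f j, v⟫_ℝ) • f j

variable [CompleteSpace X]

/-- The orthogonal projector onto `spectralSpace f s`. -/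
def specProj (f : HilbertBasis ℕ+ ℝ X) (s : Set ℕ+) : X →L[ℝ] X :=
  haveI : CompleteSpace (spectralSpace f s) :=
    (Submodule.isClosed_topologicalClosure _).completeSpace_coe
  (spectralSpace f s).starProjection

/-- The projector on the essentially lower modes `lam j < lam N - k`. -/
def projP (f : HilbertBasis ℕ+ ℝ X) (lam : ℕ+ → ℝ) (p : Params) : X →L[ℝ] X :=
  specProj f {j | lam j < lam p.N - ((p.k : ℕ) : ℝ)}

/-- The projector on the essentially higher modes `lam j > lam (N+1) + k`. -/
def projQ (f : HilbertBasis ℕ+ ℝ X) (lam : ℕ+ → ℝ) (p : Params) : X →L[ℝ] X :=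
  specProj f {j | lam j > lam (p.N + 1) + ((p.k : ℕ) : ℝ)}

/-- The projector on the intermediate modes. -/
def projI (f : HilbertBasis ℕ+ ℝ X) (lam : ℕ+ → ℝ) (p : Params) : X →L[ℝ] X :=
  ContinuousLinearMap.id ℝ X - projP f lam p - projQ f lam p

/-- The coefficient `F₁` in `𝓕_q (v, ξ) = ⟪F₁ v, v⟫ + 2 ⟪F₂ v, ξ⟫ + ⟪F₃ ξ, ξ⟫`, where, with
`I`, `P`, `Q` the three projectors, `ξ = (ξ_I, ξ_c)` and `c = a q`,
`𝓕_q (v, ξ) = τ₁ (|I ξ_I - c I v|² - δ² |I v|²) + τ₂ (|(P + Q) ξ_I|² - Λ² |I v|²)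
  + τ₃ (|ξ_c|² - Λ² |(P + Q) v|²)`. -/
def F₁ (f : HilbertBasis ℕ+ ℝ X) (lam : ℕ+ → ℝ) (p : Params) (c : ℝ) : X →L[ℝ] X :=
  (p.τ₁ * c ^ 2 - p.τ₁ * p.δ ^ 2 - p.τ₂ * p.Λ ^ 2) • projI f lam p -
    (p.τ₃ * p.Λ ^ 2) • (projP f lam p + projQ f lam p)

/-- The coefficient `F₂` of the quadratic form. -/
def F₂ (f : HilbertBasis ℕ+ ℝ X) (lam : ℕ+ → ℝ) (p : Params) (c : ℝ) : X →L[ℝ] Double X :=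
  pairing (-(p.τ₁ * c) • projI f lam p) 0

/-- The coefficient `F₃` of the quadratic form. -/
def F₃ (f : HilbertBasis ℕ+ ℝ X) (lam : ℕ+ → ℝ) (p : Params) : Double X →L[ℝ] Double X :=
  pairing ((p.τ₁ • projI f lam p + p.τ₂ • (projP f lam p + projQ f lam p)) ∘L fstD)
    (p.τ₃ • sndD)

/-- The control operator `B ξ = ξ_I + ξ_c`. -/
def B : Double X →L[ℝ] X := fstD + sndD

/-- The operator `B F₃⁻¹ F₂`. -/
def BFF (f : HilbertBasis ℕ+ ℝ X) (lam : ℕ+ → ℝ) (p : Params) (c : ℝ) : X →L[ℝ] X :=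
  B ∘L (F₃ f lam p).inverse ∘L F₂ f lam p c

/-- The bounded part of the Hamiltonian. With `A = α - A₀` and `c = a q`,
`H(q) = ( A(q) - B F₃⁻¹ F₂,   B F₃⁻¹ B* ; F₁ - F₂* F₃⁻¹ F₂,   -(A(q) - B F₃⁻¹ F₂)* )`, where
`A(q) = A - c`, equals `( A, 0 ; 0, -A ) + R`. -/
def R (f : HilbertBasis ℕ+ ℝ X) (lam : ℕ+ → ℝ) (p : Params) (c : ℝ) :
    Double X →L[ℝ] Double X :=
  pairing
    ((-BFF f lam p c - c • ContinuousLinearMap.id ℝ X) ∘L fstD +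
      (B ∘L (F₃ f lam p).inverse ∘L ContinuousLinearMap.adjoint B) ∘L sndD)
    ((F₁ f lam p c -
        ContinuousLinearMap.adjoint (F₂ f lam p c) ∘L (F₃ f lam p).inverse ∘L F₂ f lam p c)
          ∘L fstD +
      (ContinuousLinearMap.adjoint (BFF f lam p c) + c • ContinuousLinearMap.id ℝ X) ∘L sndD)

variable {Q : Type*} [TopologicalSpace Q]

/-- `z = (v, η)` is a mild solution on `[0, ∞)` of `z' = H(ϑ^t q) z`, that is, of
`v' = A v + g_v`, `η' = -A η + g_η` with `(g_v, g_η) (t) = R(ϑ^t q) z(t)`. Since `A` generates a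
forward semigroup, the Cauchy formula for `v` is solved forward in time and the one for `η`
backward in time. -/
def IsSolution (f : HilbertBasis ℕ+ ℝ X) (lam : ℕ+ → ℝ) (p : Params) (ϑ : Flow ℝ≥0 Q)
    (a : Q → ℝ) (q : Q) (z : ℝ → Double X) : Prop :=
  ContinuousOn z (Set.Ici 0) ∧
  ∀ s t : ℝ, 0 ≤ s → s ≤ t →
    (z t).fst = semigroup f lam p (t - s) (z s).fst +
      ∫ r in s..t, semigroup f lam p (t - r) (R f lam p (a (ϑ r.toNNReal q)) (z r)).fst ∧
    (z s).snd = semigroup f lam p (t - s) (z t).snd -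
      ∫ r in s..t, semigroup f lam p (r - s) (R f lam p (a (ϑ r.toNNReal q)) (z r)).snd

/-- Initial values of the solutions that are bounded on `[0, ∞)`. -/
def boundedFibre (f : HilbertBasis ℕ+ ℝ X) (lam : ℕ+ → ℝ) (p : Params) (ϑ : Flow ℝ≥0 Q)
    (a : Q → ℝ) (q : Q) : Set (Double X) :=
  {z₀ | ∃ z : ℝ → Double X, IsSolution f lam p ϑ a q z ∧ z 0 = z₀ ∧
    ∃ C : ℝ, ∀ t : ℝ, 0 ≤ t → ‖z t‖ ≤ C}

/-- Initial values of the solutions for which `exp (ε t) z(t)` belongs to `L₂(0, ∞)`. -/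
def weightedFibre (f : HilbertBasis ℕ+ ℝ X) (lam : ℕ+ → ℝ) (p : Params) (ϑ : Flow ℝ≥0 Q)
    (a : Q → ℝ) (ε : ℝ) (q : Q) : Set (Double X) :=
  {z₀ | ∃ z : ℝ → Double X, IsSolution f lam p ϑ a q z ∧ z 0 = z₀ ∧
    MemLp (fun t => Real.exp (ε * t) • z t) 2 (volume.restrict (Set.Ioi (0 : ℝ)))}

end Hamiltonian

/-- The fibre `L⁺_{b,β}(q)` in `H_β × H_β`. -/
def Lb {H : Type*} [NormedAddCommGroup H] [InnerProductSpace ℝ H] [CompleteSpace H]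
    (S : SpectralData H) {Q : Type*} [TopologicalSpace Q] (ϑ : Flow ℝ≥0 Q) (a : Q → ℝ)
    (p : Params) (β : ℝ≥0) (q : Q) : Set (Double (S.Scale β)) :=
  boundedFibre (S.scaleBasis β) S.lam p ϑ a q

/-- The fibre `L⁺_{ε,β}(q)` in `H_β × H_β`. -/
def Lε {H : Type*} [NormedAddCommGroup H] [InnerProductSpace ℝ H] [CompleteSpace H]
    (S : SpectralData H) {Q : Type*} [TopologicalSpace Q] (ϑ : Flow ℝ≥0 Q) (a : Q → ℝ)
    (p : Params) (ε : ℝ) (β : ℝ≥0) (q : Q) : Set (Double (S.Scale β)) :=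
  weightedFibre (S.scaleBasis β) S.lam p ϑ a ε q

end

end SpatAvrg

/-!
All operators in the Hamiltonian are functions of `A₀`, so the system splits into scalar planar
systems, one for each eigenvector: with `ν = α - lam j`,
`v' = κ v + b η`, `η' = -d v - κ η`,
where on the intermediate modes `κ = ν` (the contribution of `a` cancels), `b = 2`,
`d = δ² + τ₂ Λ²`, and on the other modes `κ = ν - a`, `b = τ₂⁻¹ + 1`, `d = Λ²`. Mild solutions are
exactly the continuous curves whose Fourier coefficients solve these equations
(`isSolution_iff_inner`).

Put `(x, y) = (v, η)` for `j > N` and `(x, y) = (η, -v)` for `j ≤ N`. Both cases become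
`x' = -K x + b y`, `y' = -d x + K y` (with `b` and `d` exchanged in the second case), the stable
and unstable subspaces become `y = 0` and `x = 0`, and `J (x, y) = (-y, x)`. The two hypotheses of
the theorem give `K ≥ √(b d) + μ̄ / 20` in every mode and at every time
(`modeB_mul_modeD_le`).

Under this gap the Riccati equation `m' = 2 K m - d - b m²` has a solution on the whole line with
values in `[0, √(d / b)]` (`exists_riccati`), and `K - b m ≥ μ̄ / 20`. Along a solution the defect
`w = y - m x` satisfies `w' = (K - b m) w`, hence it vanishes identically or grows exponentially,
and where it vanishes `x' = -(K - b m) x` decays. Therefore the initial values of the bounded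
solutions, and equally of the solutions in the weighted `L₂` spaces, are given by the equations
`y = m(0) x` in all modes (`IsSlopeFamily.bounded_iff`, `IsSlopeFamily.memLp_iff`). This is the
graph of a bounded operator over the stable subspace; it is Lagrange since in every mode it is a
line and `J` is the rotation by a right angle (`isLagrange_slopeGraph`).

The slopes are bounded uniformly in the modes and do not depend on `β`. Two points `q`, `q'` have
slopes that differ by at most `C ∫ exp (-2γt) |a(ϑᵗq) - a(ϑᵗq')| dt` with `C` and `γ` independent of
the mode (`abs_riccati_sub_le`), which gives the continuity in the operator norm.
-/

namespace SpatAvrg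

noncomputable section

/-! ### Scalar linear equations and bounded solutions -/

theorem hasDerivAt_primitive {k : ℝ → ℝ} (hk : Continuous k) (t : ℝ) :
    HasDerivAt (fun t => ∫ r in (0 : ℝ)..t, k r) (k t) t :=
  intervalIntegral.integral_hasDerivAt_right (hk.intervalIntegrable _ _)
    (hk.stronglyMeasurableAtFilter _ _) hk.continuousAt

theorem continuous_primitive {k : ℝ → ℝ} (hk : Continuous k) :
    Continuous (fun t => ∫ r in (0 : ℝ)..t, k r) :=
  continuous_iff_continuousAt.2 fun t => (hasDerivAt_primitive hk t).continuousAt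

theorem mul_sub_le_primitive_sub {k : ℝ → ℝ} (hk : Continuous k) {κ : ℝ} (hκ : ∀ t, κ ≤ k t)
    {s t : ℝ} (hst : s ≤ t) :
    κ * (t - s) ≤ (∫ r in (0 : ℝ)..t, k r) - ∫ r in (0 : ℝ)..s, k r := by
  rw [intervalIntegral.integral_interval_sub_left (hk.intervalIntegrable _ _)
    (hk.intervalIntegrable _ _)]
  have h := intervalIntegral.integral_mono_on (μ := volume) hst
    (intervalIntegrable_const (c := κ)) (hk.intervalIntegrable s t) fun x _ => hκ x
  rw [intervalIntegral.integral_const, smul_eq_mul] at h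
  linarith

theorem eq_of_hasDerivAt_zero {u : ℝ → ℝ} (hc : ContinuousOn u (Set.Ici 0))
    (hd : ∀ t, 0 < t → HasDerivAt u 0 t) {t : ℝ} (ht : 0 ≤ t) : u t = u 0 := by
  rcases ht.eq_or_lt with rfl | ht
  · rfl
  · obtain ⟨c, -, h⟩ := exists_hasDerivAt_eq_slope u (fun _ => 0) ht
      (hc.mono Set.Icc_subset_Ici_self) fun x hx => hd x hx.1
    rw [eq_comm, div_eq_zero_iff] at h
    rcases h with h | h <;> linarith

theorem eq_mul_exp_primitive {k u : ℝ → ℝ} (hk : Continuous k)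
    (hc : ContinuousOn u (Set.Ici 0)) (hd : ∀ t, 0 < t → HasDerivAt u (k t * u t) t)
    {t : ℝ} (ht : 0 ≤ t) : u t = u 0 * Real.exp (∫ r in (0 : ℝ)..t, k r) := by
  have h := eq_of_hasDerivAt_zero
    (u := fun t => u t * Real.exp (-∫ r in (0 : ℝ)..t, k r))
    (hc.mul (continuous_primitive hk).neg.rexp.continuousOn) (fun s hs => by
      refine ((hd s hs).mul (hasDerivAt_primitive hk s).neg.exp).congr_deriv ?_
      ring) ht
  simp only [intervalIntegral.integral_same, neg_zero, Real.exp_zero, mul_one] at h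
  rw [← h, mul_assoc, ← Real.exp_add]
  simp

/-- The function `t ↦ ∫ s in t..∞, exp (-∫ r in t..s, k r) * h s`. When `k` is bounded below by a
positive constant it is the only bounded solution of `u' = k u - h`. -/
def backwardSolution (k h : ℝ → ℝ) (t : ℝ) : ℝ :=
  Real.exp (∫ r in (0 : ℝ)..t, k r) *
    ∫ s in Set.Ioi t, Real.exp (-∫ r in (0 : ℝ)..s, k r) * h s

section Backward

variable {k h : ℝ → ℝ} {κ : ℝ}

theorem exp_primitive_le (hk : Continuous k) (hκ : ∀ t, κ ≤ k t) {s t : ℝ} (hst : t ≤ s) :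
    Real.exp (-∫ r in (0 : ℝ)..s, k r) ≤
      Real.exp (-∫ r in (0 : ℝ)..t, k r) * Real.exp (-κ * (s - t)) := by
  rw [← Real.exp_add]
  apply Real.exp_le_exp.2
  have := mul_sub_le_primitive_sub hk hκ hst
  linarith

theorem integrableOn_exp_neg_mul_sub (hκ : 0 < κ) (t : ℝ) :
    IntegrableOn (fun s => Real.exp (-κ * (s - t))) (Set.Ioi t) := by
  have h := (integrableOn_exp_mul_Ioi (neg_neg_of_pos hκ) t).mul_const (Real.exp (κ * t))
  refine IntegrableOn.congr_fun h (fun s _ => ?_) measurableSet_Ioi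
  simp only [← Real.exp_add]
  ring_nf

theorem integral_exp_neg_mul_sub (hκ : 0 < κ) (t : ℝ) :
    ∫ s in Set.Ioi t, Real.exp (-κ * (s - t)) = κ⁻¹ := by
  have : ∀ s, Real.exp (-κ * (s - t)) = Real.exp (-κ * s) * Real.exp (κ * t) := fun s => by
    rw [← Real.exp_add]
    ring_nf
  simp_rw [this]
  rw [integral_mul_const, integral_exp_mul_Ioi (neg_neg_of_pos hκ), neg_div_neg_eq,
    div_mul_eq_mul_div, ← Real.exp_add]
  simp

theorem integrableOn_backward (hk : Continuous k) (hκ : 0 < κ) (hκk : ∀ t, κ ≤ k t)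
    (hh : Continuous h) {C : ℝ} (hC : ∀ t, |h t| ≤ C) (t : ℝ) :
    IntegrableOn (fun s => Real.exp (-∫ r in (0 : ℝ)..s, k r) * h s) (Set.Ioi t) := by
  refine Integrable.mono'
    (((integrableOn_exp_neg_mul_sub hκ t).const_mul
      (Real.exp (-∫ r in (0 : ℝ)..t, k r))).mul_const C)
    ((continuous_primitive hk).neg.rexp.mul hh).aestronglyMeasurable ?_
  refine (ae_restrict_iff' measurableSet_Ioi).2 (Filter.Eventually.of_forall fun s hs => ?_)
  rw [norm_mul, Real.norm_eq_abs, Real.norm_eq_abs, Real.abs_exp]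
  exact mul_le_mul (exp_primitive_le hk hκk (le_of_lt hs)) (hC s) (abs_nonneg _) (by positivity)

theorem abs_backwardSolution_le (hk : Continuous k) (hκ : 0 < κ) (hκk : ∀ t, κ ≤ k t)
    {C : ℝ} (hC : ∀ t, |h t| ≤ C) (t : ℝ) : |backwardSolution k h t| ≤ C / κ := by
  have h1 : ‖∫ s in Set.Ioi t, Real.exp (-∫ r in (0 : ℝ)..s, k r) * h s‖ ≤
      ∫ s in Set.Ioi t, Real.exp (-∫ r in (0 : ℝ)..t, k r) * Real.exp (-κ * (s - t)) * C := by
    refine norm_integral_le_of_norm_le (((integrableOn_exp_neg_mul_sub hκ t).const_mul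
      (Real.exp (-∫ r in (0 : ℝ)..t, k r))).mul_const C) ?_
    refine (ae_restrict_iff' measurableSet_Ioi).2 (Filter.Eventually.of_forall fun s hs => ?_)
    rw [norm_mul, Real.norm_eq_abs, Real.norm_eq_abs, Real.abs_exp]
    exact mul_le_mul (exp_primitive_le hk hκk (le_of_lt hs)) (hC s) (abs_nonneg _) (by positivity)
  rw [integral_mul_const, integral_const_mul, integral_exp_neg_mul_sub hκ, Real.norm_eq_abs] at h1
  rw [backwardSolution, abs_mul, Real.abs_exp]
  refine (mul_le_mul_of_nonneg_left h1 (Real.exp_pos _).le).trans (le_of_eq ?_)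
  rw [← mul_assoc, ← mul_assoc, ← Real.exp_add, add_neg_cancel, Real.exp_zero, one_mul,
    div_eq_inv_mul]

theorem backwardSolution_nonneg (hh : ∀ t, 0 ≤ h t) (t : ℝ) : 0 ≤ backwardSolution k h t :=
  mul_nonneg (Real.exp_pos _).le (integral_nonneg fun s => mul_nonneg (Real.exp_pos _).le (hh s))

theorem hasDerivAt_backwardSolution (hk : Continuous k) (hκ : 0 < κ) (hκk : ∀ t, κ ≤ k t)
    (hh : Continuous h) {C : ℝ} (hC : ∀ t, |h t| ≤ C) (t : ℝ) :
    HasDerivAt (backwardSolution k h) (k t * backwardSolution k h t - h t) t := by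
  have hint := integrableOn_backward hk hκ hκk hh hC
  have hcont : Continuous fun s => Real.exp (-∫ r in (0 : ℝ)..s, k r) * h s :=
    (continuous_primitive hk).neg.rexp.mul hh
  have h1 : ∀ t, ∫ s in Set.Ioi t, Real.exp (-∫ r in (0 : ℝ)..s, k r) * h s =
      (∫ s in Set.Ioi 0, Real.exp (-∫ r in (0 : ℝ)..s, k r) * h s) -
        ∫ s in (0 : ℝ)..t, Real.exp (-∫ r in (0 : ℝ)..s, k r) * h s := fun t => by
    rw [← intervalIntegral.integral_Ioi_sub_Ioi' (hint 0) (hint t)]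
    ring
  have h2 := (hasDerivAt_primitive hk t).exp.mul
    ((hasDerivAt_primitive hcont t).const_sub
      (∫ s in Set.Ioi 0, Real.exp (-∫ r in (0 : ℝ)..s, k r) * h s))
  have h3 : backwardSolution k h = fun t => Real.exp (∫ r in (0 : ℝ)..t, k r) *
      ((∫ s in Set.Ioi 0, Real.exp (-∫ r in (0 : ℝ)..s, k r) * h s) -
        ∫ s in (0 : ℝ)..t, Real.exp (-∫ r in (0 : ℝ)..s, k r) * h s) := by
    funext t
    rw [backwardSolution, h1]
  rw [h3]
  refine h2.congr_deriv ?_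
  have h4 : Real.exp (∫ r in (0 : ℝ)..t, k r) * Real.exp (-∫ r in (0 : ℝ)..t, k r) = 1 := by
    rw [← Real.exp_add]
    simp
  linear_combination (-h t) * h4

theorem backwardSolution_sub {g : ℝ → ℝ} (hk : Continuous k) (hκ : 0 < κ) (hκk : ∀ t, κ ≤ k t)
    (hh : Continuous h) (hg : Continuous g) {C : ℝ} (hC : ∀ t, |h t| ≤ C) (hC' : ∀ t, |g t| ≤ C)
    (t : ℝ) : backwardSolution k h t - backwardSolution k g t =
      backwardSolution k (fun t => h t - g t) t := by
  simp only [backwardSolution]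
  rw [← mul_sub, ← integral_sub (integrableOn_backward hk hκ hκk hh hC t)
    (integrableOn_backward hk hκ hκk hg hC' t)]
  simp only [mul_sub]

/-- The equation `u' = k u` with `k ≥ κ > 0` has no bounded solution on `[0, ∞)` except zero. -/
theorem eq_zero_of_growth (hk : Continuous k) (hκ : 0 < κ) (hκk : ∀ t, κ ≤ k t) {u : ℝ → ℝ}
    (hc : ContinuousOn u (Set.Ici 0)) (hd : ∀ t, 0 < t → HasDerivAt u (k t * u t) t) {C : ℝ}
    (hC : ∀ t, 0 ≤ t → |u t| ≤ C) : u 0 = 0 := by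
  by_contra h0
  have h1 : ∀ t, 0 ≤ t → t * (|u 0| * κ) ≤ C := fun t ht => by
    have h2 := mul_sub_le_primitive_sub hk hκk ht
    simp only [intervalIntegral.integral_same, sub_zero] at h2
    have h3 := hC t ht
    rw [eq_mul_exp_primitive hk hc hd ht, abs_mul, Real.abs_exp] at h3
    have h4 := Real.add_one_le_exp (∫ r in (0 : ℝ)..t, k r)
    nlinarith [abs_pos.2 h0]
  have hpos : 0 < |u 0| * κ := mul_pos (abs_pos.2 h0) hκ
  have hC0 : 0 ≤ C := (abs_nonneg _).trans (hC 0 le_rfl)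
  have h5 := h1 ((C + 1) / (|u 0| * κ)) (by positivity)
  rw [div_mul_cancel₀ _ hpos.ne'] at h5
  linarith

/-- A bounded solution of `u' = k u - h` with `k ≥ κ > 0` is controlled at time zero by a weighted
integral of `h`, since the homogeneous equation has no bounded solution except zero. -/
theorem abs_le_integral_of_bounded (hk : Continuous k) (hκ : 0 < κ) (hκk : ∀ t, κ ≤ k t)
    (hh : Continuous h) {C : ℝ} (hC : ∀ t, |h t| ≤ C) {u : ℝ → ℝ}
    (hd : ∀ t, HasDerivAt u (k t * u t - h t) t) {D : ℝ} (hD : ∀ t, |u t| ≤ D) :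
    |u 0| ≤ ∫ s in Set.Ioi (0 : ℝ), Real.exp (-κ * s) * |h s| := by
  have hb := hasDerivAt_backwardSolution hk hκ hκk hh hC
  have hd' : ∀ t, HasDerivAt (fun t => u t - backwardSolution k h t)
      (k t * (u t - backwardSolution k h t)) t := fun t =>
    ((hd t).sub (hb t)).congr_deriv (by ring)
  -- Both `u` and `backwardSolution k h` are bounded, hence so is their difference.
  have h0 : u 0 - backwardSolution k h 0 = 0 :=
    eq_zero_of_growth (u := fun t => u t - backwardSolution k h t) (C := D + C / κ) hk hκ hκk
      (continuous_iff_continuousAt.2 fun t => (hd' t).continuousAt).continuousOn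
      (fun t _ => hd' t) fun t _ => by
        have h1 := add_le_add (hD t) (abs_backwardSolution_le hk hκ hκk hC t)
        exact (norm_sub_le (u t) (backwardSolution k h t)).trans h1
  rw [sub_eq_zero.1 h0, backwardSolution, intervalIntegral.integral_same, Real.exp_zero, one_mul,
    ← Real.norm_eq_abs]
  have hi : IntegrableOn (fun s => Real.exp (-κ * s) * |h s|) (Set.Ioi 0) :=
    (integrableOn_exp_mul_Ioi (neg_neg_of_pos hκ) 0).mul_bdd (c := C)
      hh.abs.aestronglyMeasurable (Filter.Eventually.of_forall fun s => by
        simpa using hC s)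
  refine norm_integral_le_of_norm_le hi ?_
  refine (ae_restrict_iff' measurableSet_Ioi).2 (Filter.Eventually.of_forall fun s hs => ?_)
  rw [norm_mul, Real.norm_eq_abs, Real.norm_eq_abs, Real.abs_exp]
  have := exp_primitive_le hk hκk (le_of_lt hs)
  simp only [intervalIntegral.integral_same, neg_zero, Real.exp_zero, one_mul, sub_zero] at this
  exact mul_le_mul_of_nonneg_right this (abs_nonneg _)

end Backward

/-! ### The scalar Riccati equation -/

/-- The metric projection of the real line onto `[0, r]`, for `0 ≤ r`. -/
def clamp (r x : ℝ) : ℝ := max 0 (min x r)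

theorem continuous_clamp (r : ℝ) : Continuous (clamp r) := by
  unfold clamp; fun_prop

theorem clamp_nonneg (r x : ℝ) : 0 ≤ clamp r x := le_max_left _ _

theorem clamp_le {r : ℝ} (hr : 0 ≤ r) (x : ℝ) : clamp r x ≤ r := max_le hr (min_le_right _ _)

theorem clamp_eq {r x : ℝ} (h0 : 0 ≤ x) (h1 : x ≤ r) : clamp r x = x := by
  rw [clamp, min_eq_left h1, max_eq_right h0]

theorem abs_clamp_sub_le (r x y : ℝ) : |clamp r x - clamp r y| ≤ |x - y| := by
  unfold clamp
  have h1 := abs_max_sub_max_le_max 0 (min x r) 0 (min y r)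
  have h2 := abs_min_sub_min_le_max x r y r
  simp only [sub_self, abs_zero, abs_nonneg, max_eq_right, max_eq_left] at h1 h2
  exact h1.trans h2

/-- Under the strict hyperbolicity condition `K ≥ b r + γ`, the Riccati equation
`m' = 2 K m - b (r² + m²)` has a solution on the whole line with values in `[0, r]`. It is the
fixed point of the contraction sending `m` to the bounded solution `u` of
`u' = 2 K u - b (r² + m²)`. -/
theorem exists_riccati {K : ℝ → ℝ} (hK : Continuous K) {b r γ : ℝ} (hb : 0 < b) (hr : 0 < r)
    (hγ : 0 < γ) (hKγ : ∀ t, b * r + γ ≤ K t) :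
    ∃ m : ℝ → ℝ, (∀ t, HasDerivAt m (2 * K t * m t - b * (r ^ 2 + m t ^ 2)) t) ∧
      ∀ t, 0 ≤ m t ∧ m t ≤ r := by
  set κ : ℝ := 2 * (b * r + γ) with hκdef
  have hbr : 0 < b * r := mul_pos hb hr
  have hκ : 0 < κ := by positivity
  set k : ℝ → ℝ := fun t => 2 * K t with hkdef
  have hk : Continuous k := by fun_prop
  have hκk : ∀ t, κ ≤ k t := fun t => by
    have := hKγ t
    simp only [hκdef, hkdef]; linarith
  -- Clamping makes the right-hand side Lipschitz in `m` without restricting the complete space;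
  -- the fixed point takes its values in `[0, r]`, where the clamp is the identity.
  let h : (ℝ → ℝ) → ℝ → ℝ := fun m t => b * (r ^ 2 + clamp r (m t) ^ 2)
  have hh0 : ∀ m t, 0 ≤ h m t := fun m t => by positivity
  have hh : ∀ m t, |h m t| ≤ 2 * (b * r ^ 2) := fun m t => by
    rw [abs_of_nonneg (hh0 m t)]
    have h1 : clamp r (m t) ^ 2 ≤ r ^ 2 :=
      pow_le_pow_left₀ (clamp_nonneg _ _) (clamp_le hr.le _) 2
    have h2 := mul_le_mul_of_nonneg_left h1 hb.le
    simp only [h]; linarith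
  have hhc : ∀ m, Continuous m → Continuous (h m) := fun m hm => by
    have := (continuous_clamp r).comp hm
    have h2 : Continuous fun t => clamp r (m t) := this
    simp only [h]; fun_prop
  have hbound : 2 * (b * r ^ 2) / κ ≤ r := by
    rw [div_le_iff₀ hκ, hκdef]; nlinarith [mul_pos hr hγ]
  have hder := fun m (hm : Continuous m) =>
    hasDerivAt_backwardSolution hk hκ hκk (hhc m hm) (hh m)
  let T : BoundedContinuousFunction ℝ ℝ → BoundedContinuousFunction ℝ ℝ := fun m =>
    BoundedContinuousFunction.ofNormedAddCommGroup (backwardSolution k (h m))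
      (continuous_iff_continuousAt.2 fun t => (hder m m.continuous t).continuousAt)
      (2 * (b * r ^ 2) / κ) (abs_backwardSolution_le hk hκ hκk (hh m))
  have hT : ∀ m t, T m t = backwardSolution k (h m) t := fun m t => rfl
  have hq0 : 0 ≤ 2 * (b * r) / κ := by positivity
  have hcontr : ContractingWith (Real.toNNReal (2 * (b * r) / κ)) T := by
    refine ⟨?_, LipschitzWith.of_dist_le_mul fun m n => ?_⟩
    · rw [← NNReal.coe_lt_coe, Real.coe_toNNReal _ hq0, NNReal.coe_one, div_lt_one hκ]
      linarith
    · rw [Real.coe_toNNReal _ hq0]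
      refine (BoundedContinuousFunction.dist_le (by positivity)).2 fun t => ?_
      rw [Real.dist_eq, hT, hT, backwardSolution_sub hk hκ hκk (hhc m m.continuous)
        (hhc n n.continuous) (hh m) (hh n), div_mul_eq_mul_div]
      refine abs_backwardSolution_le hk hκ hκk (fun s => ?_) t
      have h1 : h m s - h n s = b * (clamp r (m s) + clamp r (n s)) *
          (clamp r (m s) - clamp r (n s)) := by simp only [h]; ring
      rw [h1, abs_mul, abs_of_nonneg
        (mul_nonneg hb.le (add_nonneg (clamp_nonneg _ _) (clamp_nonneg _ _)))]
      refine mul_le_mul ?_ ?_ (abs_nonneg _) (by positivity)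
      · have h2 := add_le_add (clamp_le hr.le (m s)) (clamp_le hr.le (n s))
        have h3 := mul_le_mul_of_nonneg_left h2 hb.le
        linarith
      · exact (abs_clamp_sub_le _ _ _).trans
          ((Real.dist_eq _ _).symm.trans_le (BoundedContinuousFunction.dist_coe_le_dist s))
  set m := hcontr.fixedPoint T with hm
  have hfix : ∀ t, backwardSolution k (h m) t = m t := fun t => by
    rw [← hT, hm, hcontr.fixedPoint_isFixedPt]
  have hrange : ∀ t, 0 ≤ m t ∧ m t ≤ r := fun t => by
    rw [← hfix]
    exact ⟨backwardSolution_nonneg (hh0 m) t,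
      (le_abs_self _).trans ((abs_backwardSolution_le hk hκ hκk (hh m) t).trans hbound)⟩
  refine ⟨m, fun t => ?_, hrange⟩
  have h1 := hder m m.continuous t
  rw [show backwardSolution k (h m) = m from funext hfix] at h1
  simpa only [h, hkdef, clamp_eq (hrange t).1 (hrange t).2] using h1

/-- Two solutions of Riccati equations with values in `[0, r]` differ at time zero by at most a
weighted integral of the difference of the coefficients; the weight depends on the hyperbolicity
gap only. -/
theorem abs_riccati_sub_le {K₁ K₂ : ℝ → ℝ} (hK₁ : Continuous K₁) (hK₂ : Continuous K₂)
    {b r γ : ℝ} (hb : 0 < b) (hγ : 0 < γ) (hKγ : ∀ t, b * r + γ ≤ K₁ t)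
    {m₁ m₂ : ℝ → ℝ} (hm₁ : ∀ t, HasDerivAt m₁ (2 * K₁ t * m₁ t - b * (r ^ 2 + m₁ t ^ 2)) t)
    (hm₂ : ∀ t, HasDerivAt m₂ (2 * K₂ t * m₂ t - b * (r ^ 2 + m₂ t ^ 2)) t)
    (hr₁ : ∀ t, 0 ≤ m₁ t ∧ m₁ t ≤ r) (hr₂ : ∀ t, 0 ≤ m₂ t ∧ m₂ t ≤ r)
    {Δ : ℝ → ℝ} (hΔ : Continuous Δ) (hKΔ : ∀ t, |K₁ t - K₂ t| ≤ |Δ t|)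
    {C : ℝ} (hC : ∀ t, |Δ t| ≤ C) :
    |m₁ 0 - m₂ 0| ≤ 2 * r * ∫ s in Set.Ioi (0 : ℝ), Real.exp (-(2 * γ) * s) * |Δ s| := by
  have hc₁ : Continuous m₁ := continuous_iff_continuousAt.2 fun t => (hm₁ t).continuousAt
  have hc₂ : Continuous m₂ := continuous_iff_continuousAt.2 fun t => (hm₂ t).continuousAt
  have hr : 0 ≤ r := (hr₁ 0).1.trans (hr₁ 0).2
  set h : ℝ → ℝ := fun t => -2 * (K₁ t - K₂ t) * m₂ t with hh
  have hhΔ : ∀ t, |h t| ≤ 2 * r * |Δ t| := fun t => by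
    have h1 := mul_le_mul (hKΔ t) (hr₂ t).2 (hr₂ t).1 (abs_nonneg _)
    rw [hh]
    simp only [abs_mul, abs_neg, abs_two, abs_of_nonneg (hr₂ t).1]
    linarith
  have h1 := abs_le_integral_of_bounded (κ := 2 * γ) (u := fun t => m₁ t - m₂ t) (h := h)
    (k := fun t => 2 * K₁ t - b * (m₁ t + m₂ t)) (C := 2 * r * C) (D := r)
    (by fun_prop) (by positivity) (fun t => ?_) (by rw [hh]; fun_prop)
    (fun t => (hhΔ t).trans (mul_le_mul_of_nonneg_left (hC t) (by positivity)))
    (fun t => ((hm₁ t).sub (hm₂ t)).congr_deriv (by rw [hh]; ring))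
    (fun t => abs_sub_le_of_nonneg_of_le (hr₁ t).1 (hr₁ t).2 (hr₂ t).1 (hr₂ t).2)
  · refine h1.trans ?_
    rw [← integral_const_mul]
    have hi := integrableOn_exp_mul_Ioi (neg_neg_of_pos (show 0 < 2 * γ by positivity)) 0
    refine integral_mono_of_nonneg
      (Filter.Eventually.of_forall fun s => mul_nonneg (Real.exp_pos _).le (abs_nonneg _))
      ((hi.mul_bdd (c := C) hΔ.abs.aestronglyMeasurable
        (Filter.Eventually.of_forall fun s => by simpa using hC s)).const_mul _)
      (Filter.Eventually.of_forall fun s => ?_)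
    have := mul_le_mul_of_nonneg_left (hhΔ s) (Real.exp_pos (-(2 * γ) * s)).le
    simp only
    linarith
  · have h2 := add_le_add (hr₁ t).2 (hr₂ t).2
    have h3 := mul_le_mul_of_nonneg_left h2 hb.le
    have := hKγ t
    linarith

section Modes

variable {X : Type*} [NormedAddCommGroup X] [InnerProductSpace ℝ X]

/-! ### Stable and unstable coordinates -/

@[simp] theorem fstD_apply (z : Double X) : fstD z = z.fst := rfl

@[simp] theorem sndD_apply (z : Double X) : sndD z = z.snd := rfl

@[simp] theorem pairing_fst {Y : Type*} [NormedAddCommGroup Y] [InnerProductSpace ℝ Y]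
    (S T : Y →L[ℝ] X) (y : Y) : (pairing S T y).fst = S y := rfl

@[simp] theorem pairing_snd {Y : Type*} [NormedAddCommGroup Y] [InnerProductSpace ℝ Y]
    (S T : Y →L[ℝ] X) (y : Y) : (pairing S T y).snd = T y := rfl

/-- The stable coordinate of `z = (v, η)` in the mode `j`: the `j`-th Fourier coefficient of `v`
if `j > N`, and that of `η` if `j ≤ N`. -/
def modeX (f : HilbertBasis ℕ+ ℝ X) (p : Params) (j : ℕ+) : Double X →L[ℝ] ℝ :=
  if p.N < j then innerSL ℝ (f j) ∘L fstD else innerSL ℝ (f j) ∘L sndD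

/-- The unstable coordinate of `z = (v, η)` in the mode `j`: the `j`-th Fourier coefficient of `η`
if `j > N`, and that of `-v` if `j ≤ N`. With this sign `J (x, y) = (-y, x)` in every mode. -/
def modeY (f : HilbertBasis ℕ+ ℝ X) (p : Params) (j : ℕ+) : Double X →L[ℝ] ℝ :=
  if p.N < j then innerSL ℝ (f j) ∘L sndD else -(innerSL ℝ (f j) ∘L fstD)

variable {f : HilbertBasis ℕ+ ℝ X} {p : Params}

theorem modeX_of_lt {j : ℕ+} (h : p.N < j) (z : Double X) : modeX f p j z = ⟪f j, z.fst⟫_ℝ := by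
  simp [modeX, h]

theorem modeX_of_not_lt {j : ℕ+} (h : ¬p.N < j) (z : Double X) :
    modeX f p j z = ⟪f j, z.snd⟫_ℝ := by
  simp [modeX, h]

theorem modeY_of_lt {j : ℕ+} (h : p.N < j) (z : Double X) : modeY f p j z = ⟪f j, z.snd⟫_ℝ := by
  simp [modeY, h]

theorem modeY_of_not_lt {j : ℕ+} (h : ¬p.N < j) (z : Double X) :
    modeY f p j z = -⟪f j, z.fst⟫_ℝ := by
  simp [modeY, h]

/-- Parseval's identity in the stable and unstable coordinates. -/
theorem hasSum_mode_mul (z w : Double X) :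
    HasSum (fun j => modeX f p j z * modeX f p j w + modeY f p j z * modeY f p j w)
      ⟪z, w⟫_ℝ := by
  have h := (f.hasSum_inner_mul_inner z.fst w.fst).add (f.hasSum_inner_mul_inner z.snd w.snd)
  rw [WithLp.prod_inner_apply]
  refine h.congr_fun ?_
  intro j
  by_cases hj : p.N < j
  · rw [modeX_of_lt hj, modeX_of_lt hj, modeY_of_lt hj, modeY_of_lt hj,
      real_inner_comm (f j) z.fst, real_inner_comm (f j) z.snd]
  · rw [modeX_of_not_lt hj, modeX_of_not_lt hj, modeY_of_not_lt hj, modeY_of_not_lt hj,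
      real_inner_comm (f j) z.fst, real_inner_comm (f j) z.snd]
    ring

variable (f p) in
theorem hasSum_mode_sq (z : Double X) :
    HasSum (fun j => modeX f p j z ^ 2 + modeY f p j z ^ 2) (‖z‖ ^ 2) := by
  rw [← real_inner_self_eq_norm_sq]
  simpa only [sq] using hasSum_mode_mul (f := f) (p := p) z z

theorem mode_sq_le (j : ℕ+) (z : Double X) :
    modeX f p j z ^ 2 + modeY f p j z ^ 2 ≤ ‖z‖ ^ 2 :=
  le_hasSum (hasSum_mode_sq f p z) j fun _ _ => by positivity

theorem abs_modeX_le (j : ℕ+) (z : Double X) : |modeX f p j z| ≤ ‖z‖ :=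
  abs_le_of_sq_le_sq (by nlinarith [mode_sq_le (f := f) (p := p) j z, sq_nonneg (modeY f p j z)])
    (norm_nonneg _)

theorem abs_modeY_le (j : ℕ+) (z : Double X) : |modeY f p j z| ≤ ‖z‖ :=
  abs_le_of_sq_le_sq (by nlinarith [mode_sq_le (f := f) (p := p) j z, sq_nonneg (modeX f p j z)])
    (norm_nonneg _)

theorem norm_le_of_mode_sq_le {z w : Double X} {C : ℝ} (hC : 0 ≤ C)
    (h : ∀ j, modeX f p j z ^ 2 + modeY f p j z ^ 2 ≤
      C ^ 2 * (modeX f p j w ^ 2 + modeY f p j w ^ 2)) : ‖z‖ ≤ C * ‖w‖ := by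
  refine le_of_sq_le_sq ?_ (by positivity)
  rw [mul_pow]
  exact hasSum_le h (hasSum_mode_sq f p z) ((hasSum_mode_sq f p w).mul_left _)

theorem ext_modes {z w : Double X} (hx : ∀ j, modeX f p j z = modeX f p j w)
    (hy : ∀ j, modeY f p j z = modeY f p j w) : z = w := by
  have h := norm_le_of_mode_sq_le (f := f) (p := p) (z := z - w) (w := 0) (C := 0) le_rfl
    fun j => by simp [hx j, hy j]
  rw [zero_mul] at h
  exact sub_eq_zero.1 (norm_le_zero_iff.1 h)

theorem exists_repr {u : ℕ+ → ℝ} (hu : Summable fun j => u j ^ 2) :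
    ∃ v : X, ∀ j, ⟪f j, v⟫_ℝ = u j := by
  have hmem : Memℓp u 2 := by
    refine (memℓp_gen_iff (by norm_num)).2 ?_
    simpa using hu
  refine ⟨f.repr.symm ⟨u, hmem⟩, fun j => ?_⟩
  rw [← f.repr_apply_apply]
  simp

variable (f p) in
theorem exists_modes {x y : ℕ+ → ℝ} (h : Summable fun j => x j ^ 2 + y j ^ 2) :
    ∃ z : Double X, ∀ j, modeX f p j z = x j ∧ modeY f p j z = y j := by
  obtain ⟨v, hv⟩ := exists_repr (f := f) (u := fun j => if p.N < j then x j else -y j)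
    (h.of_nonneg_of_le (fun _ => sq_nonneg _) fun j => by
      by_cases hj : p.N < j <;> simp [hj, sq_nonneg])
  obtain ⟨η, hη⟩ := exists_repr (f := f) (u := fun j => if p.N < j then y j else x j)
    (h.of_nonneg_of_le (fun _ => sq_nonneg _) fun j => by
      by_cases hj : p.N < j <;> simp [hj, sq_nonneg])
  refine ⟨WithLp.toLp 2 (v, η), fun j => ?_⟩
  by_cases hj : p.N < j
  · rw [modeX_of_lt hj, modeY_of_lt hj]
    exact ⟨by simpa [hj] using hv j, by simpa [hj] using hη j⟩
  · rw [modeX_of_not_lt hj, modeY_of_not_lt hj]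
    exact ⟨by simpa [hj] using hη j, by simpa [hj, neg_eq_iff_eq_neg] using hv j⟩

theorem modeX_J (j : ℕ+) (z : Double X) : modeX f p j (J z) = -modeY f p j z := by
  by_cases hj : p.N < j
  · rw [modeX_of_lt hj, modeY_of_lt hj]
    simp [J, inner_neg_right]
  · rw [modeX_of_not_lt hj, modeY_of_not_lt hj]
    simp [J]

theorem modeY_J (j : ℕ+) (z : Double X) : modeY f p j (J z) = modeX f p j z := by
  by_cases hj : p.N < j
  · rw [modeX_of_lt hj, modeY_of_lt hj]
    simp [J]
  · rw [modeX_of_not_lt hj, modeY_of_not_lt hj]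
    simp [J, inner_neg_right]

/-- Convergence in every mode implies convergence in norm if the squared coordinates have a common
summable majorant. -/
theorem tendsto_of_modes {ι : Type*} {l : Filter ι} {z : ι → Double X} {w : Double X}
    (hx : ∀ j, Filter.Tendsto (fun i => modeX f p j (z i)) l (nhds (modeX f p j w)))
    (hy : ∀ j, Filter.Tendsto (fun i => modeY f p j (z i)) l (nhds (modeY f p j w)))
    {C : ℕ+ → ℝ} (hC : Summable C)
    (hz : ∀ i j, modeX f p j (z i) ^ 2 + modeY f p j (z i) ^ 2 ≤ C j)
    (hw : ∀ j, modeX f p j w ^ 2 + modeY f p j w ^ 2 ≤ C j) :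
    Filter.Tendsto z l (nhds w) := by
  have h1 : Filter.Tendsto (fun i => ‖z i - w‖ ^ 2) l (nhds 0) := by
    have h2 : ∀ i, ‖z i - w‖ ^ 2 =
        ∑' j, (modeX f p j (z i - w) ^ 2 + modeY f p j (z i - w) ^ 2) := fun i =>
      (hasSum_mode_sq f p _).tsum_eq.symm
    simp_rw [h2]
    rw [show (0 : ℝ) = ∑' _ : ℕ+, (0 : ℝ) by simp]
    refine tendsto_tsum_of_dominated_convergence (bound := fun j => 4 * C j) (hC.mul_left 4)
      (fun j => ?_) (Filter.Eventually.of_forall fun i j => ?_)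
    · simp only [map_sub]
      have h3 := (((hx j).sub_const (modeX f p j w)).pow 2).add
        (((hy j).sub_const (modeY f p j w)).pow 2)
      simpa using h3
    · rw [Real.norm_of_nonneg (by positivity), map_sub, map_sub]
      have h3 := hz i j
      have h4 := hw j
      nlinarith [sq_nonneg (modeX f p j (z i) + modeX f p j w),
        sq_nonneg (modeY f p j (z i) + modeY f p j w)]
  rw [tendsto_iff_norm_sub_tendsto_zero]
  have h5 := h1.sqrt
  simpa using h5

/-! ### Spectral subspaces and projectors -/

theorem inner_basis (i j : ℕ+) : ⟪f i, f j⟫_ℝ = if i = j then 1 else 0 := by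
  classical
  have := orthonormal_iff_ite.1 f.orthonormal i j
  simpa using this

theorem ext_inner_basis {v w : X} (h : ∀ j, ⟪f j, v⟫_ℝ = ⟪f j, w⟫_ℝ) : v = w := by
  apply f.repr.injective
  ext j
  rw [f.repr_apply_apply, f.repr_apply_apply, h]

theorem ext_inner_double {z w : Double X} (h₁ : ∀ j, ⟪f j, z.fst⟫_ℝ = ⟪f j, w.fst⟫_ℝ)
    (h₂ : z.snd = w.snd) : z = w :=
  (WithLp.ofLp_injective 2) (Prod.ext (ext_inner_basis h₁) h₂)

theorem basis_mem_spectralSpace {s : Set ℕ+} {j : ℕ+} (hj : j ∈ s) : f j ∈ spectralSpace f s :=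
  Submodule.le_topologicalClosure _ (Submodule.subset_span ⟨j, hj, rfl⟩)

theorem mem_spectralSpace_iff {s : Set ℕ+} {v : X} :
    v ∈ spectralSpace f s ↔ ∀ j ∉ s, ⟪f j, v⟫_ℝ = 0 := by
  constructor
  · intro hv j hj
    have h : spectralSpace f s ≤ LinearMap.ker (innerSL ℝ (f j)).toLinearMap := by
      refine Submodule.topologicalClosure_minimal _ (Submodule.span_le.2 ?_)
        (innerSL ℝ (f j)).isClosed_ker
      rintro _ ⟨i, hi, rfl⟩
      have hij : j ≠ i := fun h => hj (h ▸ hi)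
      simp [inner_basis, hij]
    simpa using h hv
  · intro hv
    refine (Submodule.isClosed_topologicalClosure _).mem_of_tendsto (f.hasSum_repr v)
      (Filter.Eventually.of_forall fun t => ?_)
    refine Submodule.sum_mem _ fun j _ => ?_
    by_cases hj : j ∈ s
    · exact Submodule.smul_mem _ _ (basis_mem_spectralSpace hj)
    · rw [f.repr_apply_apply, hv j hj, zero_smul]
      exact Submodule.zero_mem _

theorem mem_stableSpace_iff {z : Double X} :
    z ∈ stableSpace f p ↔ ∀ j, modeY f p j z = 0 := by
  simp only [stableSpace, Submodule.mem_inf, Submodule.mem_comap, ContinuousLinearMap.coe_coe,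
    fstD_apply, sndD_apply, mem_spectralSpace_iff, Set.mem_ofPred_eq]
  constructor
  · rintro ⟨h1, h2⟩ j
    by_cases hj : p.N < j
    · rw [modeY_of_lt hj]; exact h2 j (not_le.2 hj)
    · rw [modeY_of_not_lt hj, h1 j hj, neg_zero]
  · intro h
    refine ⟨fun j hj => ?_, fun j hj => ?_⟩
    · have := h j
      rwa [modeY_of_not_lt hj, neg_eq_zero] at this
    · have := h j
      rwa [modeY_of_lt (not_le.1 hj)] at this

theorem mem_unstableSpace_iff {z : Double X} :
    z ∈ unstableSpace f p ↔ ∀ j, modeX f p j z = 0 := by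
  simp only [unstableSpace, Submodule.mem_inf, Submodule.mem_comap, ContinuousLinearMap.coe_coe,
    fstD_apply, sndD_apply, mem_spectralSpace_iff, Set.mem_ofPred_eq]
  constructor
  · rintro ⟨h1, h2⟩ j
    by_cases hj : p.N < j
    · rw [modeX_of_lt hj]; exact h1 j (not_le.2 hj)
    · rw [modeX_of_not_lt hj, h2 j hj]
  · intro h
    refine ⟨fun j hj => ?_, fun j hj => ?_⟩
    · have := h j
      rwa [modeX_of_lt (not_le.1 hj)] at this
    · have := h j
      rwa [modeX_of_not_lt hj] at this

/-- A bounded sequence `m` defines a bounded operator from the stable to the unstable subspace: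
in every mode `j` the unstable coordinate of the value is `m j` times the stable coordinate of the
argument. -/
theorem exists_slopeOp (f : HilbertBasis ℕ+ ℝ X) (p : Params) {m : ℕ+ → ℝ} {C : ℝ}
    (hm : ∀ j, |m j| ≤ C) :
    ∃ M : stableSpace f p →L[ℝ] unstableSpace f p,
      ∀ z j, modeY f p j (M z : Double X) = m j * modeX f p j (z : Double X) := by
  have hC : 0 ≤ C := (abs_nonneg _).trans (hm 1)
  have hle : ∀ (z : Double X) j, (m j * modeX f p j z) ^ 2 ≤
      C ^ 2 * (modeX f p j z ^ 2 + modeY f p j z ^ 2) := fun z j => by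
    have h1 : m j ^ 2 ≤ C ^ 2 := sq_le_sq' (abs_le.1 (hm j)).1 (abs_le.1 (hm j)).2
    rw [mul_pow]
    exact mul_le_mul h1 (le_add_of_nonneg_right (sq_nonneg _)) (sq_nonneg _) (sq_nonneg _)
  have hex : ∀ z : stableSpace f p, ∃ w : unstableSpace f p,
      ∀ j, modeY f p j (w : Double X) = m j * modeX f p j (z : Double X) := fun z => by
    obtain ⟨w, hw⟩ := exists_modes f p (x := fun _ => 0)
      (y := fun j => m j * modeX f p j (z : Double X))
      (Summable.of_nonneg_of_le (fun j => by positivity)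
        (fun j => by simpa using hle z j) ((hasSum_mode_sq f p (z : Double X)).summable.mul_left _))
    exact ⟨⟨w, mem_unstableSpace_iff.2 fun j => (hw j).1⟩, fun j => (hw j).2⟩
  choose M hM using hex
  have hext : ∀ w w' : unstableSpace f p,
      (∀ j, modeY f p j (w : Double X) = modeY f p j (w' : Double X)) → w = w' := fun w w' h =>
    Subtype.ext (ext_modes (f := f) (p := p) (fun j => by
      rw [mem_unstableSpace_iff.1 w.2, mem_unstableSpace_iff.1 w'.2]) h)
  refine ⟨LinearMap.mkContinuous
    { toFun := M
      map_add' := fun z w => hext _ _ fun j => by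
        simp only [Submodule.coe_add, map_add, hM]; ring
      map_smul' := fun c z => hext _ _ fun j => by
        simp only [Submodule.coe_smul, map_smul, hM, RingHom.id_apply, smul_eq_mul]; ring } C
    fun z => ?_, fun z j => hM z j⟩
  refine norm_le_of_mode_sq_le (f := f) (p := p) hC fun j => ?_
  change modeX f p j (M z : Double X) ^ 2 + modeY f p j (M z : Double X) ^ 2 ≤ _
  rw [mem_unstableSpace_iff.1 (M z).2, hM]
  simpa using hle z j

theorem norm_le_of_slopes {M : stableSpace f p →L[ℝ] unstableSpace f p} {m : ℕ+ → ℝ}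
    (hM : ∀ z j, modeY f p j (M z : Double X) = m j * modeX f p j (z : Double X))
    {C : ℝ} (hm : ∀ j, |m j| ≤ C) : ‖M‖ ≤ C := by
  have hC : 0 ≤ C := (abs_nonneg _).trans (hm 1)
  refine M.opNorm_le_bound hC fun z => ?_
  refine norm_le_of_mode_sq_le (f := f) (p := p) hC fun j => ?_
  have h1 : m j ^ 2 ≤ C ^ 2 := sq_le_sq' (abs_le.1 (hm j)).1 (abs_le.1 (hm j)).2
  change modeX f p j (M z : Double X) ^ 2 + modeY f p j (M z : Double X) ^ 2 ≤
    C ^ 2 * (modeX f p j (z : Double X) ^ 2 + modeY f p j (z : Double X) ^ 2)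
  rw [mem_unstableSpace_iff.1 (M z).2, hM, mem_stableSpace_iff.1 z.2, mul_pow]
  have := mul_le_mul_of_nonneg_right h1 (sq_nonneg (modeX f p j (z : Double X)))
  simpa using this

variable [CompleteSpace X]

theorem inner_specProj (s : Set ℕ+) [DecidablePred (· ∈ s)] (j : ℕ+) (v : X) :
    ⟪f j, specProj f s v⟫_ℝ = if j ∈ s then ⟪f j, v⟫_ℝ else 0 := by
  have : CompleteSpace (spectralSpace f s) :=
    (Submodule.isClosed_topologicalClosure _).completeSpace_coe
  change ⟪f j, (spectralSpace f s).starProjection v⟫_ℝ = _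
  split_ifs with hj
  · have h := (spectralSpace f s).starProjection_inner_eq_zero v (f j) (basis_mem_spectralSpace hj)
    rw [inner_sub_left, sub_eq_zero] at h
    rw [real_inner_comm, ← h, real_inner_comm]
  · exact mem_spectralSpace_iff.1 ((spectralSpace f s).starProjection_apply_mem v) j hj

end Modes

section Coefficients

variable {X : Type*} [NormedAddCommGroup X] [InnerProductSpace ℝ X] [CompleteSpace X]
  {f : HilbertBasis ℕ+ ℝ X} {lam : ℕ+ → ℝ} {p : Params}

/-! ### The Hamiltonian in coordinates -/

/-- The modes outside the intermediate spectrum, that is, the indices of the eigenvectors in the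
range of `projP + projQ`. -/
abbrev Outer (lam : ℕ+ → ℝ) (p : Params) (j : ℕ+) : Prop :=
  lam j < lam p.N - ((p.k : ℕ) : ℝ) ∨ lam (p.N + 1) + ((p.k : ℕ) : ℝ) < lam j

theorem inner_projP_add_projQ (hmono : Monotone lam) (j : ℕ+) (v : X) :
    ⟪f j, projP f lam p v⟫_ℝ + ⟪f j, projQ f lam p v⟫_ℝ =
      if Outer lam p j then ⟪f j, v⟫_ℝ else 0 := by
  classical
  have h1 : lam p.N ≤ lam (p.N + 1) := hmono (PNat.lt_add_right p.N 1).le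
  have h2 : (0 : ℝ) < ((p.k : ℕ) : ℝ) := by exact_mod_cast p.k.pos
  rw [projP, projQ, inner_specProj, inner_specProj]
  simp only [Set.mem_ofPred_eq, gt_iff_lt, Outer]
  by_cases hP : lam j < lam p.N - ((p.k : ℕ) : ℝ)
  · have hQ : ¬lam (p.N + 1) + ((p.k : ℕ) : ℝ) < lam j := by linarith
    simp [hP, hQ]
  · simp [hP]

theorem inner_projI (hmono : Monotone lam) (j : ℕ+) (v : X) :
    ⟪f j, projI f lam p v⟫_ℝ = if Outer lam p j then 0 else ⟪f j, v⟫_ℝ := by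
  have h := inner_projP_add_projQ (f := f) (p := p) hmono j v
  simp only [projI, sub_apply, ContinuousLinearMap.id_apply, inner_sub_right]
  split_ifs at h ⊢ <;> linarith

theorem projI_basis (hmono : Monotone lam) (j : ℕ+) :
    projI f lam p (f j) = if Outer lam p j then 0 else f j := by
  refine ext_inner_basis (f := f) fun i => ?_
  rw [inner_projI hmono]
  by_cases hij : i = j
  · subst hij
    split_ifs <;> simp
  · have : ⟪f i, f j⟫_ℝ = 0 := by rw [inner_basis, if_neg hij]
    split_ifs <;> simp [this]

theorem inner_F₃_fst (hmono : Monotone lam) (j : ℕ+) (ξ : Double X) :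
    ⟪f j, (F₃ f lam p ξ).fst⟫_ℝ =
      (if Outer lam p j then p.τ₂ else p.τ₁) * ⟪f j, ξ.fst⟫_ℝ := by
  have h1 := inner_projP_add_projQ (f := f) (p := p) hmono j ξ.fst
  have h2 := inner_projI (f := f) (p := p) hmono j ξ.fst
  simp only [F₃, pairing_fst, ContinuousLinearMap.comp_apply, add_apply,
    smul_apply, fstD_apply, inner_add_right, inner_smul_right, h1, h2]
  split_ifs <;> simp

theorem F₃_snd (ξ : Double X) : (F₃ f lam p ξ).snd = p.τ₃ • ξ.snd := by
  simp [F₃]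

/-- The inverse of `F₃` is given by the same formula with inverted weights. -/
theorem inverse_F₃ (hmono : Monotone lam) (h₁ : p.τ₁ ≠ 0) (h₂ : p.τ₂ ≠ 0) (h₃ : p.τ₃ ≠ 0) :
    (F₃ f lam p).inverse =
      F₃ f lam { p with τ₁ := p.τ₁⁻¹, τ₂ := p.τ₂⁻¹, τ₃ := p.τ₃⁻¹ } := by
  set p' : Params := { p with τ₁ := p.τ₁⁻¹, τ₂ := p.τ₂⁻¹, τ₃ := p.τ₃⁻¹ } with hp'
  let e : Double X ≃L[ℝ] Double X :=
    ContinuousLinearEquiv.equivOfInverse (F₃ f lam p) (F₃ f lam p')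
      (fun ξ => ext_inner_double (f := f) (fun j => by
        rw [inner_F₃_fst hmono, inner_F₃_fst hmono]
        simp only [hp']
        split_ifs <;> field_simp) (by
        rw [F₃_snd, F₃_snd, smul_smul, inv_mul_cancel₀ h₃, one_smul]))
      (fun ξ => ext_inner_double (f := f) (fun j => by
        rw [inner_F₃_fst hmono, inner_F₃_fst hmono]
        simp only [hp']
        split_ifs <;> field_simp) (by
        rw [F₃_snd, F₃_snd, smul_smul, mul_inv_cancel₀ h₃, one_smul]))
  have he : (F₃ f lam p) = (e : Double X →L[ℝ] Double X) := rfl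
  rw [he, ContinuousLinearMap.inverse_equiv]
  rfl

theorem adjoint_B_apply (v : X) :
    ContinuousLinearMap.adjoint (B : Double X →L[ℝ] X) v = WithLp.toLp 2 (v, v) := by
  refine ext_inner_right ℝ fun ξ => ?_
  rw [ContinuousLinearMap.adjoint_inner_left, WithLp.prod_inner_apply]
  simp [B, inner_add_right]

/-- On the intermediate modes `B F₃⁻¹ F₂ = -c`, which cancels the term `-c` of `A(q) = A - c` in
`A(q) - B F₃⁻¹ F₂`; on the other modes `B F₃⁻¹ F₂` vanishes. -/
theorem inner_BFF (hmono : Monotone lam) (h₁ : p.τ₁ ≠ 0) (h₂ : p.τ₂ ≠ 0) (h₃ : p.τ₃ ≠ 0)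
    (c : ℝ) (j : ℕ+) (v : X) :
    ⟪f j, BFF f lam p c v⟫_ℝ = (if Outer lam p j then 0 else -c) * ⟪f j, v⟫_ℝ := by
  simp only [BFF, inverse_F₃ hmono h₁ h₂ h₃, ContinuousLinearMap.comp_apply, B,
    add_apply, fstD_apply, sndD_apply, F₃_snd,
    inner_F₃_fst hmono, F₂, pairing_fst, pairing_snd, smul_apply,
    zero_apply, smul_zero, add_zero, inner_smul_right,
    inner_projI hmono]
  split_ifs
  · ring
  · field_simp

theorem inner_adjoint_BFF (hmono : Monotone lam) (h₁ : p.τ₁ ≠ 0) (h₂ : p.τ₂ ≠ 0)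
    (h₃ : p.τ₃ ≠ 0) (c : ℝ) (j : ℕ+) (v : X) :
    ⟪f j, ContinuousLinearMap.adjoint (BFF f lam p c) v⟫_ℝ =
      (if Outer lam p j then 0 else -c) * ⟪f j, v⟫_ℝ := by
  have hb : BFF f lam p c (f j) = (if Outer lam p j then (0 : ℝ) else -c) • f j := by
    refine ext_inner_basis (f := f) fun i => ?_
    rw [inner_BFF hmono h₁ h₂ h₃, inner_smul_right, inner_basis]
    by_cases hij : i = j
    · rw [hij]
    · simp [hij]
  rw [ContinuousLinearMap.adjoint_inner_right, hb, inner_smul_left]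
  rfl

theorem inner_B_inverse_adjoint_B (hmono : Monotone lam) (h₁ : p.τ₁ ≠ 0) (h₂ : p.τ₂ ≠ 0)
    (h₃ : p.τ₃ ≠ 0) (j : ℕ+) (v : X) :
    ⟪f j, B ((F₃ f lam p).inverse (ContinuousLinearMap.adjoint B v))⟫_ℝ =
      ((if Outer lam p j then p.τ₂⁻¹ else p.τ₁⁻¹) + p.τ₃⁻¹) * ⟪f j, v⟫_ℝ := by
  rw [inverse_F₃ hmono h₁ h₂ h₃, adjoint_B_apply]
  simp only [B, add_apply, fstD_apply, sndD_apply, inner_add_right, F₃_snd,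
    inner_F₃_fst hmono, inner_smul_right, add_mul]
  rfl

theorem inner_adjoint_F₂ (hmono : Monotone lam) (c : ℝ) (j : ℕ+) (ξ : Double X) :
    ⟪f j, ContinuousLinearMap.adjoint (F₂ f lam p c) ξ⟫_ℝ =
      (if Outer lam p j then 0 else -(p.τ₁ * c)) * ⟪f j, ξ.fst⟫_ℝ := by
  rw [ContinuousLinearMap.adjoint_inner_right, WithLp.prod_inner_apply]
  simp only [F₂]
  change ⟪(-(p.τ₁ * c) • projI f lam p) (f j), ξ.fst⟫_ℝ + ⟪(0 : X →L[ℝ] X) (f j), ξ.snd⟫_ℝ = _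
  rw [smul_apply, projI_basis hmono]
  split_ifs <;> simp [inner_smul_left]

theorem inner_F₁_sub (hmono : Monotone lam) (h₁ : p.τ₁ ≠ 0) (h₂ : p.τ₂ ≠ 0) (h₃ : p.τ₃ ≠ 0)
    (c : ℝ) (j : ℕ+) (v : X) :
    ⟪f j, F₁ f lam p c v - ContinuousLinearMap.adjoint (F₂ f lam p c)
        ((F₃ f lam p).inverse (F₂ f lam p c v))⟫_ℝ =
      -(if Outer lam p j then p.τ₃ * p.Λ ^ 2 else p.τ₁ * p.δ ^ 2 + p.τ₂ * p.Λ ^ 2) *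
        ⟪f j, v⟫_ℝ := by
  have h4 := inner_projP_add_projQ (f := f) (p := p) hmono j v
  have h5 := inner_projI (f := f) (p := p) hmono j v
  rw [inner_sub_right, inner_adjoint_F₂ hmono, inverse_F₃ hmono h₁ h₂ h₃, inner_F₃_fst hmono]
  simp only [F₁, F₂, pairing_fst, sub_apply, smul_apply,
    add_apply, inner_sub_right, inner_add_right, inner_smul_right, h4, h5]
  split_ifs
  · ring
  · field_simp
    ring

/-- The coefficient of `η` in the equation for `v` in the mode `j`. -/
def modeB (lam : ℕ+ → ℝ) (p : Params) (j : ℕ+) : ℝ := if Outer lam p j then p.τ₂⁻¹ + 1 else 2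

/-- The coefficient of `-v` in the equation for `η` in the mode `j`. -/
def modeD (lam : ℕ+ → ℝ) (p : Params) (j : ℕ+) : ℝ :=
  if Outer lam p j then p.Λ ^ 2 else p.δ ^ 2 + p.τ₂ * p.Λ ^ 2

/-- The contribution of `a q = c` to the mode `j`: it cancels on the intermediate modes. -/
def modeShift (lam : ℕ+ → ℝ) (p : Params) (c : ℝ) (j : ℕ+) : ℝ := if Outer lam p j then c else 0

theorem inner_R_fst (hmono : Monotone lam) (h₁ : p.τ₁ = 1) (h₂ : p.τ₂ ≠ 0) (h₃ : p.τ₃ = 1)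
    (c : ℝ) (j : ℕ+) (z : Double X) :
    ⟪f j, (R f lam p c z).fst⟫_ℝ =
      -modeShift lam p c j * ⟪f j, z.fst⟫_ℝ + modeB lam p j * ⟪f j, z.snd⟫_ℝ := by
  have h₁' : p.τ₁ ≠ 0 := by simp [h₁]
  have h₃' : p.τ₃ ≠ 0 := by simp [h₃]
  simp only [R, pairing_fst, add_apply, sub_apply,
    neg_apply, smul_apply, ContinuousLinearMap.comp_apply,
    ContinuousLinearMap.id_apply, fstD_apply, sndD_apply, inner_add_right, inner_sub_right,
    inner_neg_right, inner_smul_right, inner_BFF hmono h₁' h₂ h₃',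
    inner_B_inverse_adjoint_B hmono h₁' h₂ h₃']
  simp only [modeShift, modeB, h₁, h₃]
  split_ifs <;> ring

theorem inner_R_snd (hmono : Monotone lam) (h₁ : p.τ₁ = 1) (h₂ : p.τ₂ ≠ 0) (h₃ : p.τ₃ = 1)
    (c : ℝ) (j : ℕ+) (z : Double X) :
    ⟪f j, (R f lam p c z).snd⟫_ℝ =
      -modeD lam p j * ⟪f j, z.fst⟫_ℝ + modeShift lam p c j * ⟪f j, z.snd⟫_ℝ := by
  have h₁' : p.τ₁ ≠ 0 := by simp [h₁]
  have h₃' : p.τ₃ ≠ 0 := by simp [h₃]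
  simp only [R, pairing_snd, add_apply, sub_apply,
    smul_apply, ContinuousLinearMap.comp_apply,
    ContinuousLinearMap.id_apply, fstD_apply, sndD_apply, inner_add_right,
    inner_smul_right, inner_adjoint_BFF hmono h₁' h₂ h₃']
  rw [inner_F₁_sub hmono h₁' h₂ h₃']
  simp only [modeShift, modeD, h₁, h₃]
  split_ifs <;> ring

end Coefficients

/-! ### Mild solutions and the equations of the modes -/

/-- The forward Cauchy formula is equivalent to `u' = ν u + g` on `(0, ∞)`. -/
theorem mild_forward_iff {u g : ℝ → ℝ} (hu : ContinuousOn u (Set.Ici 0))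
    (hg : ContinuousOn g (Set.Ici 0)) (ν : ℝ) :
    (∀ s t : ℝ, 0 ≤ s → s ≤ t → u t = Real.exp ((t - s) * ν) * u s +
      ∫ r in s..t, Real.exp ((t - r) * ν) * g r) ↔
    ∀ t, 0 < t → HasDerivAt u (ν * u t + g t) t := by
  constructor
  · intro h t ht
    have hG : ContinuousOn (fun r => Real.exp (-r * ν) * g r) (Set.Ici 0) :=
      ContinuousOn.mul (by fun_prop) hg
    have h1 : HasDerivAt (fun t => ∫ r in (0 : ℝ)..t, Real.exp (-r * ν) * g r)
        (Real.exp (-t * ν) * g t) t :=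
      intervalIntegral.integral_hasDerivAt_right
        ((hG.mono (by rw [Set.uIcc_of_le ht.le]; exact Set.Icc_subset_Ici_self)).intervalIntegrable)
        ((hG.mono Set.Ioi_subset_Ici_self).stronglyMeasurableAtFilter isOpen_Ioi t ht)
        (hG.continuousAt (Ici_mem_nhds ht))
    have h2 : HasDerivAt (fun t : ℝ => Real.exp (t * ν)) (Real.exp (t * ν) * ν) t := by
      simpa using ((hasDerivAt_id t).mul_const ν).exp
    have h3 := h2.mul (h1.const_add (u 0))
    have h4 : ∀ t, 0 ≤ t → Real.exp (t * ν) *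
        (u 0 + ∫ r in (0 : ℝ)..t, Real.exp (-r * ν) * g r) = u t := fun t ht => by
      rw [h 0 t le_rfl ht, mul_add, ← intervalIntegral.integral_const_mul, sub_zero]
      congr 2
      funext r
      rw [← mul_assoc, ← Real.exp_add]
      ring_nf
    refine (h3.congr_deriv ?_).congr_of_eventuallyEq ?_
    · have h5 : Real.exp (t * ν) * Real.exp (-t * ν) = 1 := by
        rw [← Real.exp_add]; simp
      rw [← h4 t ht.le]
      linear_combination g t * h5
    · filter_upwards [Ioi_mem_nhds ht] with r hr
      exact (h4 r (le_of_lt hr)).symm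
  · intro h s t hs hst
    have hsub : Set.Icc s t ⊆ Set.Ici 0 := fun r hr => hs.trans hr.1
    have h1 := intervalIntegral.integral_eq_sub_of_hasDerivAt_of_le
      (f := fun r => Real.exp ((t - r) * ν) * u r)
      (f' := fun r => Real.exp ((t - r) * ν) * g r) hst
      (ContinuousOn.mul (by fun_prop) (hu.mono hsub)) (fun r hr => ?_)
      (ContinuousOn.intervalIntegrable (by
        rw [Set.uIcc_of_le hst]
        exact ContinuousOn.mul (by fun_prop) (hg.mono hsub)))
    · rw [h1]
      simp
    · have h2 : HasDerivAt (fun r : ℝ => Real.exp ((t - r) * ν))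
          (Real.exp ((t - r) * ν) * (-1 * ν)) r :=
        (((hasDerivAt_id r).const_sub t).mul_const ν).exp
      exact (h2.mul (h r (hs.trans_lt hr.1))).congr_deriv (by ring)

/-- The backward Cauchy formula is equivalent to `u' = -ν u + g` on `(0, ∞)`: after multiplication
by an exponential it becomes the forward formula for `-ν`. -/
theorem mild_backward_iff {u g : ℝ → ℝ} (hu : ContinuousOn u (Set.Ici 0))
    (hg : ContinuousOn g (Set.Ici 0)) (ν : ℝ) :
    (∀ s t : ℝ, 0 ≤ s → s ≤ t → u s = Real.exp ((t - s) * ν) * u t -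
      ∫ r in s..t, Real.exp ((r - s) * ν) * g r) ↔
    ∀ t, 0 < t → HasDerivAt u (-ν * u t + g t) t := by
  rw [← mild_forward_iff hu hg (-ν)]
  refine forall₂_congr fun s t => forall₂_congr fun _ _ => ?_
  have h1 : Real.exp ((t - s) * ν) * Real.exp ((t - s) * -ν) = 1 := by
    rw [← Real.exp_add]; simp
  have h2 : ∫ r in s..t, Real.exp ((r - s) * ν) * g r =
      Real.exp ((t - s) * ν) * ∫ r in s..t, Real.exp ((t - r) * -ν) * g r := by
    rw [← intervalIntegral.integral_const_mul]
    congr 1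
    funext r
    rw [← mul_assoc, ← Real.exp_add]
    ring_nf
  rw [h2]
  set E := Real.exp ((t - s) * ν)
  set E' := Real.exp ((t - s) * -ν)
  constructor
  · intro h
    linear_combination (-E') * h - (u t - ∫ r in s..t, Real.exp ((t - r) * -ν) * g r) * h1
  · intro h
    linear_combination (-E) * h - u s * h1

section Solutions

variable {X : Type*} [NormedAddCommGroup X] [InnerProductSpace ℝ X]
  {f : HilbertBasis ℕ+ ℝ X} {lam : ℕ+ → ℝ} {p : Params}

theorem hasSum_inner_sq (f : HilbertBasis ℕ+ ℝ X) (v : X) :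
    HasSum (fun j => ⟪f j, v⟫_ℝ ^ 2) (‖v‖ ^ 2) := by
  rw [← real_inner_self_eq_norm_sq]
  refine (f.hasSum_inner_mul_inner v v).congr_fun fun j => ?_
  rw [real_inner_comm v, sq]

theorem norm_le_of_inner_sq_le {w v η : X} {C : ℝ} (hC : 0 ≤ C)
    (h : ∀ j, ⟪f j, w⟫_ℝ ^ 2 ≤ C ^ 2 * (⟪f j, v⟫_ℝ ^ 2 + ⟪f j, η⟫_ℝ ^ 2)) :
    ‖w‖ ≤ C * (‖v‖ + ‖η‖) := by
  have h1 := hasSum_le h (hasSum_inner_sq f w)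
    (((hasSum_inner_sq f v).add (hasSum_inner_sq f η)).mul_left (C ^ 2))
  refine le_of_sq_le_sq (h1.trans ?_) (by positivity)
  rw [mul_pow]
  exact mul_le_mul_of_nonneg_left
    (by nlinarith [mul_nonneg (norm_nonneg v) (norm_nonneg η)]) (sq_nonneg _)

/-- Measurability and integrability of a bounded function with values in `X` can be read off from
its Fourier coefficients, as the function is the limit of the partial sums of its expansion. -/
theorem intervalIntegrable_of_inner {g : ℝ → X} {s t : ℝ} (hst : s ≤ t)
    (hg : ∀ j, ContinuousOn (fun r => ⟪f j, g r⟫_ℝ) (Set.Icc s t)) {C : ℝ}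
    (hC : ∀ r ∈ Set.Icc s t, ‖g r‖ ≤ C) : IntervalIntegrable g volume s t := by
  rw [intervalIntegrable_iff_integrableOn_Icc_of_le hst]
  have hmeas : AEStronglyMeasurable g (volume.restrict (Set.Icc s t)) := by
    refine aestronglyMeasurable_of_tendsto_ae Filter.atTop
      (f := fun (T : Finset ℕ+) r => ∑ j ∈ T, ⟪f j, g r⟫_ℝ • f j) (fun T => ?_)
      (Filter.Eventually.of_forall fun r => ?_)
    · exact (continuousOn_finsetSum T fun j _ =>
        (hg j).smul continuousOn_const).aestronglyMeasurable measurableSet_Icc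
    · have := f.hasSum_repr (g r)
      simp only [f.repr_apply_apply] at this
      exact this
  exact Integrable.of_bound hmeas C
    ((ae_restrict_iff' measurableSet_Icc).2 (Filter.Eventually.of_forall hC))

theorem inner_semigroup_sq_le (hmono : Monotone lam) {t : ℝ} (ht : 0 ≤ t) (j : ℕ+) (v : X) :
    (Real.exp (t * (p.α lam - lam j)) * ⟪f j, v⟫_ℝ) ^ 2 ≤
      Real.exp (t * |p.α lam - lam 1|) ^ 2 * ⟪f j, v⟫_ℝ ^ 2 := by
  rw [mul_pow]
  refine mul_le_mul_of_nonneg_right (pow_le_pow_left₀ (Real.exp_pos _).le ?_ 2) (sq_nonneg _)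
  refine Real.exp_le_exp.2 (mul_le_mul_of_nonneg_left ?_ ht)
  exact (sub_le_sub_left (hmono (one_le (a := j))) _).trans (le_abs_self _)

theorem inner_semigroup (hmono : Monotone lam) {t : ℝ} (ht : 0 ≤ t) (j : ℕ+) (v : X) :
    ⟪f j, semigroup f lam p t v⟫_ℝ = Real.exp (t * (p.α lam - lam j)) * ⟪f j, v⟫_ℝ := by
  obtain ⟨w, hw⟩ := exists_repr (f := f)
    (u := fun j => Real.exp (t * (p.α lam - lam j)) * ⟪f j, v⟫_ℝ)
    (Summable.of_nonneg_of_le (fun j => sq_nonneg _)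
      (fun j => inner_semigroup_sq_le (p := p) hmono ht j v)
      ((hasSum_inner_sq f v).summable.mul_left _))
  have h := f.hasSum_repr w
  simp only [f.repr_apply_apply, hw] at h
  rw [semigroup, h.tsum_eq, hw]

theorem norm_semigroup_le (hmono : Monotone lam) {t : ℝ} (ht : 0 ≤ t) (v : X) :
    ‖semigroup f lam p t v‖ ≤ Real.exp (t * |p.α lam - lam 1|) * ‖v‖ := by
  have h := norm_le_of_inner_sq_le (f := f) (w := semigroup f lam p t v) (v := v) (η := 0)
    (Real.exp_pos (t * |p.α lam - lam 1|)).le fun j => by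
      rw [inner_semigroup hmono ht]
      simpa using inner_semigroup_sq_le (f := f) (p := p) hmono ht j v
  simpa using h

theorem intervalIntegrable_semigroup (hmono : Monotone lam) {τ : ℝ → ℝ} (hτ : Continuous τ)
    {s t : ℝ} (hst : s ≤ t) (hτ0 : ∀ r ∈ Set.Icc s t, 0 ≤ τ r ∧ τ r ≤ t - s)
    {g : ℝ → X} (hg : ∀ j, ContinuousOn (fun r => ⟪f j, g r⟫_ℝ) (Set.Icc s t))
    {C : ℝ} (hC : ∀ r ∈ Set.Icc s t, ‖g r‖ ≤ C) :
    IntervalIntegrable (fun r => semigroup f lam p (τ r) (g r)) volume s t := by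
  refine intervalIntegrable_of_inner (f := f)
    (C := Real.exp ((t - s) * |p.α lam - lam 1|) * C) hst (fun j => ?_) fun r hr => ?_
  · refine ContinuousOn.congr (f := fun r => Real.exp (τ r * (p.α lam - lam j)) * ⟪f j, g r⟫_ℝ)
      (ContinuousOn.mul (by fun_prop) (hg j)) fun r hr => inner_semigroup hmono (hτ0 r hr).1 j _
  · refine (norm_semigroup_le hmono (hτ0 r hr).1 _).trans ?_
    refine mul_le_mul (Real.exp_le_exp.2 ?_) (hC r hr) (norm_nonneg _) (Real.exp_pos _).le
    exact mul_le_mul_of_nonneg_right (hτ0 r hr).2 (abs_nonneg _)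

variable [CompleteSpace X]

theorem inner_integral_semigroup (hmono : Monotone lam) {τ : ℝ → ℝ} (hτ : Continuous τ)
    {s t : ℝ} (hst : s ≤ t) (hτ0 : ∀ r ∈ Set.Icc s t, 0 ≤ τ r ∧ τ r ≤ t - s)
    {g : ℝ → X} (hg : ∀ j, ContinuousOn (fun r => ⟪f j, g r⟫_ℝ) (Set.Icc s t))
    {C : ℝ} (hC : ∀ r ∈ Set.Icc s t, ‖g r‖ ≤ C) (j : ℕ+) :
    ⟪f j, ∫ r in s..t, semigroup f lam p (τ r) (g r)⟫_ℝ =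
      ∫ r in s..t, Real.exp (τ r * (p.α lam - lam j)) * ⟪f j, g r⟫_ℝ := by
  have h := (innerSL ℝ (f j)).intervalIntegral_comp_comm
    (intervalIntegrable_semigroup (p := p) hmono hτ hst hτ0 hg hC)
  simp only [innerSL_apply_apply] at h
  rw [← h]
  refine intervalIntegral.integral_congr fun r hr => ?_
  rw [Set.uIcc_of_le hst] at hr
  exact inner_semigroup hmono (hτ0 r hr).1 j _

/-- The bounded parts `R c` with `|c| ≤ D` are uniformly bounded; this makes the integrands of the
mild formulation integrable. -/
theorem exists_norm_R_le (f : HilbertBasis ℕ+ ℝ X) (hmono : Monotone lam) (h₁ : p.τ₁ = 1)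
    (h₂ : p.τ₂ ≠ 0) (h₃ : p.τ₃ = 1) (D : ℝ) :
    ∃ C : ℝ, 0 ≤ C ∧ ∀ c : ℝ, |c| ≤ D → ∀ z : Double X,
      ‖(R f lam p c z).fst‖ ≤ C * (‖z.fst‖ + ‖z.snd‖) ∧
      ‖(R f lam p c z).snd‖ ≤ C * (‖z.fst‖ + ‖z.snd‖) := by
  have key : ∀ {α β E v η : ℝ}, |α| + |β| ≤ E →
      (α * v + β * η) ^ 2 ≤ E ^ 2 * (v ^ 2 + η ^ 2) := fun {α β E v η} h => by
    have h1 : α ^ 2 + β ^ 2 ≤ E ^ 2 := by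
      rw [← sq_abs α, ← sq_abs β]
      nlinarith [abs_nonneg α, abs_nonneg β]
    have h2 := mul_le_mul_of_nonneg_right h1 (add_nonneg (sq_nonneg v) (sq_nonneg η))
    nlinarith [sq_nonneg (α * η - β * v)]
  have hs : ∀ (c : ℝ) j, |modeShift lam p c j| ≤ |c| := fun c j => by
    unfold modeShift; split_ifs <;> simp
  have hb : ∀ j, |modeB lam p j| ≤ |p.τ₂⁻¹ + 1| + 2 := fun j => by
    unfold modeB; split_ifs
    · linarith
    · rw [abs_two]; linarith [abs_nonneg (p.τ₂⁻¹ + 1)]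
  have hd : ∀ j, |modeD lam p j| ≤ |p.Λ ^ 2| + |p.δ ^ 2 + p.τ₂ * p.Λ ^ 2| := fun j => by
    unfold modeD; split_ifs
    · linarith [abs_nonneg (p.δ ^ 2 + p.τ₂ * p.Λ ^ 2)]
    · linarith [abs_nonneg (p.Λ ^ 2)]
  set C := |D| + (|p.τ₂⁻¹ + 1| + 2) + (|p.Λ ^ 2| + |p.δ ^ 2 + p.τ₂ * p.Λ ^ 2|) with hC
  have hC0 : 0 ≤ C := by positivity
  have hB0 : 0 ≤ |p.τ₂⁻¹ + 1| + 2 := by positivity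
  have hD0 : 0 ≤ |p.Λ ^ 2| + |p.δ ^ 2 + p.τ₂ * p.Λ ^ 2| := by positivity
  refine ⟨C, hC0, fun c hc z => ⟨?_, ?_⟩⟩
  · refine norm_le_of_inner_sq_le (f := f) hC0 fun j => ?_
    rw [inner_R_fst hmono h₁ h₂ h₃]
    refine key ?_
    rw [abs_neg]
    linarith [hs c j, hb j, le_abs_self D]
  · refine norm_le_of_inner_sq_le (f := f) hC0 fun j => ?_
    rw [inner_R_snd hmono h₁ h₂ h₃]
    refine key ?_
    rw [abs_neg]
    linarith [hs c j, hd j, le_abs_self D]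

variable {Q : Type*} [TopologicalSpace Q]

/-- The mild formulation of the Hamiltonian system is equivalent to the system of decoupled scalar
equations satisfied by the Fourier coefficients of `v` and `η`. -/
theorem isSolution_iff_inner (hmono : Monotone lam) (h₁ : p.τ₁ = 1) (h₂ : p.τ₂ ≠ 0)
    (h₃ : p.τ₃ = 1) {ϑ : Flow ℝ≥0 Q} {a : Q → ℝ} (ha : Continuous a) {D : ℝ}
    (hD : ∀ q, |a q| ≤ D) {q : Q} {z : ℝ → Double X} :
    IsSolution f lam p ϑ a q z ↔ ContinuousOn z (Set.Ici 0) ∧ ∀ j, ∀ t, 0 < t →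
      HasDerivAt (fun t => ⟪f j, (z t).fst⟫_ℝ)
        ((p.α lam - lam j - modeShift lam p (a (ϑ t.toNNReal q)) j) * ⟪f j, (z t).fst⟫_ℝ +
          modeB lam p j * ⟪f j, (z t).snd⟫_ℝ) t ∧
      HasDerivAt (fun t => ⟪f j, (z t).snd⟫_ℝ)
        (-modeD lam p j * ⟪f j, (z t).fst⟫_ℝ -
          (p.α lam - lam j - modeShift lam p (a (ϑ t.toNNReal q)) j) * ⟪f j, (z t).snd⟫_ℝ) t := by
  unfold IsSolution
  refine and_congr_right fun hz => ?_
  have hc : Continuous fun t : ℝ => a (ϑ t.toNNReal q) := by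
    have h1 : Continuous fun t : ℝ => ϑ t.toNNReal q :=
      ϑ.continuous continuous_real_toNNReal continuous_const
    exact ha.comp h1
  have hsh : ∀ j, Continuous fun t : ℝ => modeShift lam p (a (ϑ t.toNNReal q)) j := fun j => by
    unfold modeShift
    split_ifs
    · exact hc
    · exact continuous_const
  have hv : ∀ j, ContinuousOn (fun t => ⟪f j, (z t).fst⟫_ℝ) (Set.Ici 0) := fun j =>
    ((innerSL ℝ (f j) ∘L fstD).continuous.comp_continuousOn hz)
  have hη : ∀ j, ContinuousOn (fun t => ⟪f j, (z t).snd⟫_ℝ) (Set.Ici 0) := fun j =>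
    ((innerSL ℝ (f j) ∘L sndD).continuous.comp_continuousOn hz)
  have hgv : ∀ j, ContinuousOn (fun t => ⟪f j, (R f lam p (a (ϑ t.toNNReal q)) (z t)).fst⟫_ℝ)
      (Set.Ici 0) := fun j => by
    simp only [inner_R_fst hmono h₁ h₂ h₃]
    exact ((hsh j).neg.continuousOn.mul (hv j)).add (continuousOn_const.mul (hη j))
  have hgη : ∀ j, ContinuousOn (fun t => ⟪f j, (R f lam p (a (ϑ t.toNNReal q)) (z t)).snd⟫_ℝ)
      (Set.Ici 0) := fun j => by
    simp only [inner_R_snd hmono h₁ h₂ h₃]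
    exact (continuousOn_const.mul (hv j)).add ((hsh j).continuousOn.mul (hη j))
  obtain ⟨C, hC0, hC⟩ := exists_norm_R_le f hmono h₁ h₂ h₃ D
  have hbound : ∀ s t : ℝ, 0 ≤ s → ∃ C', ∀ r ∈ Set.Icc s t,
      ‖(R f lam p (a (ϑ r.toNNReal q)) (z r)).fst‖ ≤ C' ∧
      ‖(R f lam p (a (ϑ r.toNNReal q)) (z r)).snd‖ ≤ C' := fun s t hs => by
    have hz' := hz.mono (show Set.Icc s t ⊆ Set.Ici 0 from fun r hr => hs.trans hr.1)
    obtain ⟨C₁, hC₁⟩ := isCompact_Icc.exists_bound_of_continuousOn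
      ((fstD (X := X)).continuous.comp_continuousOn hz')
    obtain ⟨C₂, hC₂⟩ := isCompact_Icc.exists_bound_of_continuousOn
      ((sndD (X := X)).continuous.comp_continuousOn hz')
    refine ⟨C * (C₁ + C₂), fun r hr => ?_⟩
    have h4 := mul_le_mul_of_nonneg_left (add_le_add (hC₁ r hr) (hC₂ r hr)) hC0
    exact ⟨(hC _ (hD _) _).1.trans h4, (hC _ (hD _) _).2.trans h4⟩
  have hsub : ∀ {s t : ℝ}, 0 ≤ s → Set.Icc s t ⊆ Set.Ici 0 := fun hs r hr => hs.trans hr.1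
  have hcoord : (∀ s t : ℝ, 0 ≤ s → s ≤ t →
      (z t).fst = semigroup f lam p (t - s) (z s).fst +
        ∫ r in s..t, semigroup f lam p (t - r) (R f lam p (a (ϑ r.toNNReal q)) (z r)).fst ∧
      (z s).snd = semigroup f lam p (t - s) (z t).snd -
        ∫ r in s..t, semigroup f lam p (r - s) (R f lam p (a (ϑ r.toNNReal q)) (z r)).snd) ↔
      ∀ j, (∀ s t : ℝ, 0 ≤ s → s ≤ t → ⟪f j, (z t).fst⟫_ℝ =
          Real.exp ((t - s) * (p.α lam - lam j)) * ⟪f j, (z s).fst⟫_ℝ +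
          ∫ r in s..t, Real.exp ((t - r) * (p.α lam - lam j)) *
            ⟪f j, (R f lam p (a (ϑ r.toNNReal q)) (z r)).fst⟫_ℝ) ∧
        (∀ s t : ℝ, 0 ≤ s → s ≤ t → ⟪f j, (z s).snd⟫_ℝ =
          Real.exp ((t - s) * (p.α lam - lam j)) * ⟪f j, (z t).snd⟫_ℝ -
          ∫ r in s..t, Real.exp ((r - s) * (p.α lam - lam j)) *
            ⟪f j, (R f lam p (a (ϑ r.toNNReal q)) (z r)).snd⟫_ℝ) := by
    have h5 : ∀ s t : ℝ, 0 ≤ s → s ≤ t → ∀ j,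
        ⟪f j, semigroup f lam p (t - s) (z s).fst +
          ∫ r in s..t, semigroup f lam p (t - r)
            (R f lam p (a (ϑ r.toNNReal q)) (z r)).fst⟫_ℝ =
          Real.exp ((t - s) * (p.α lam - lam j)) * ⟪f j, (z s).fst⟫_ℝ +
          ∫ r in s..t, Real.exp ((t - r) * (p.α lam - lam j)) *
            ⟪f j, (R f lam p (a (ϑ r.toNNReal q)) (z r)).fst⟫_ℝ := fun s t hs hst j => by
      obtain ⟨C', hC'⟩ := hbound s t hs
      rw [inner_add_right, inner_semigroup hmono (sub_nonneg.2 hst),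
        inner_integral_semigroup (τ := fun r => t - r) hmono (by fun_prop) hst
          (fun r hr => ⟨sub_nonneg.2 hr.2, sub_le_sub_left hr.1 t⟩)
          (fun j => (hgv j).mono (hsub hs)) fun r hr => (hC' r hr).1]
    have h6 : ∀ s t : ℝ, 0 ≤ s → s ≤ t → ∀ j,
        ⟪f j, semigroup f lam p (t - s) (z t).snd -
          ∫ r in s..t, semigroup f lam p (r - s)
            (R f lam p (a (ϑ r.toNNReal q)) (z r)).snd⟫_ℝ =
          Real.exp ((t - s) * (p.α lam - lam j)) * ⟪f j, (z t).snd⟫_ℝ -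
          ∫ r in s..t, Real.exp ((r - s) * (p.α lam - lam j)) *
            ⟪f j, (R f lam p (a (ϑ r.toNNReal q)) (z r)).snd⟫_ℝ := fun s t hs hst j => by
      obtain ⟨C', hC'⟩ := hbound s t hs
      rw [inner_sub_right, inner_semigroup hmono (sub_nonneg.2 hst),
        inner_integral_semigroup (τ := fun r => r - s) hmono (by fun_prop) hst
          (fun r hr => ⟨sub_nonneg.2 hr.1, sub_le_sub_right hr.2 s⟩)
          (fun j => (hgη j).mono (hsub hs)) fun r hr => (hC' r hr).2]
    constructor
    · intro h j
      exact ⟨fun s t hs hst => by rw [← h5 s t hs hst j, ← (h s t hs hst).1],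
        fun s t hs hst => by rw [← h6 s t hs hst j, ← (h s t hs hst).2]⟩
    · intro h s t hs hst
      exact ⟨ext_inner_basis (f := f) fun j => by rw [h5 s t hs hst j, (h j).1 s t hs hst],
        ext_inner_basis (f := f) fun j => by rw [h6 s t hs hst j, (h j).2 s t hs hst]⟩
  rw [hcoord]
  refine forall_congr' fun j => ?_
  rw [mild_forward_iff (hv j) (hgv j), mild_backward_iff (hη j) (hgη j), ← forall₂_and]
  refine forall₂_congr fun t _ => ?_
  rw [inner_R_fst hmono h₁ h₂ h₃, inner_R_snd hmono h₁ h₂ h₃]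
  refine and_congr (Eq.to_iff ?_) (Eq.to_iff ?_)
  · congr 1; ring
  · congr 1; ring

/-- `z` is continuous on `[0, ∞)` and its stable and unstable coordinates `x` and `y` satisfy
`x' = -K x + b y`, `y' = -d x + K y` in every mode. -/
def IsModeSolution (f : HilbertBasis ℕ+ ℝ X) (p : Params) (K : ℕ+ → ℝ → ℝ) (b d : ℕ+ → ℝ)
    (z : ℝ → Double X) : Prop :=
  ContinuousOn z (Set.Ici 0) ∧ ∀ j, ∀ t, 0 < t →
    HasDerivAt (fun t => modeX f p j (z t))
      (-K j t * modeX f p j (z t) + b j * modeY f p j (z t)) t ∧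
    HasDerivAt (fun t => modeY f p j (z t))
      (-d j * modeX f p j (z t) + K j t * modeY f p j (z t)) t

/-- The coefficient `K` of the mode `j` in the stable and unstable coordinates, for `a q = c`. The
sign is chosen so that `K` is positive in all modes under the hypotheses of the theorem. -/
def rate (lam : ℕ+ → ℝ) (p : Params) (c : ℝ) (j : ℕ+) : ℝ :=
  if p.N < j then modeShift lam p c j - (p.α lam - lam j)
  else p.α lam - lam j - modeShift lam p c j

/-- The coefficient of the unstable coordinate in the equation of the stable one. -/
def rateB (lam : ℕ+ → ℝ) (p : Params) (j : ℕ+) : ℝ :=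
  if p.N < j then modeB lam p j else modeD lam p j

/-- The coefficient of minus the stable coordinate in the equation of the unstable one. -/
def rateD (lam : ℕ+ → ℝ) (p : Params) (j : ℕ+) : ℝ :=
  if p.N < j then modeD lam p j else modeB lam p j

theorem isSolution_iff_isModeSolution (hmono : Monotone lam) (h₁ : p.τ₁ = 1) (h₂ : p.τ₂ ≠ 0)
    (h₃ : p.τ₃ = 1) {ϑ : Flow ℝ≥0 Q} {a : Q → ℝ} (ha : Continuous a) {D : ℝ}
    (hD : ∀ q, |a q| ≤ D) {q : Q} {z : ℝ → Double X} :
    IsSolution f lam p ϑ a q z ↔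
      IsModeSolution f p (fun j t => rate lam p (a (ϑ t.toNNReal q)) j) (rateB lam p)
        (rateD lam p) z := by
  rw [isSolution_iff_inner hmono h₁ h₂ h₃ ha hD, IsModeSolution]
  refine and_congr_right fun _ => forall_congr' fun j => forall₂_congr fun t _ => ?_
  by_cases hj : p.N < j
  · simp only [modeX_of_lt hj, modeY_of_lt hj, rate, rateB, rateD, hj, if_true]
    refine and_congr (Eq.to_iff ?_) (Eq.to_iff ?_)
    · congr 1; ring
    · congr 1; ring
  · simp only [modeX_of_not_lt hj, modeY_of_not_lt hj, rate, rateB, rateD, hj, if_false]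
    rw [and_comm]
    refine and_congr (Eq.to_iff ?_) ?_
    · congr 1; ring
    · constructor
      · intro h
        exact h.neg.congr_deriv (by ring)
      · intro h
        have h' := h.neg
        simp only [Pi.neg_def, neg_neg] at h'
        exact h'.congr_deriv (by ring)

end Solutions

section Fibre

variable {X : Type*} [NormedAddCommGroup X] [InnerProductSpace ℝ X]
  {f : HilbertBasis ℕ+ ℝ X} {p : Params}

/-! ### Graphs over the stable subspace -/

/-- The set of all `z` whose unstable coordinate is `m j` times the stable one in every mode. -/
def slopeGraph (f : HilbertBasis ℕ+ ℝ X) (p : Params) (m : ℕ+ → ℝ) :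
    Submodule ℝ (Double X) where
  carrier := {z | ∀ j, modeY f p j z = m j * modeX f p j z}
  zero_mem' := fun j => by simp
  add_mem' := fun {z w} hz hw j => by rw [map_add, map_add, hz j, hw j, mul_add]
  smul_mem' := fun c z hz j => by
    rw [map_smul, map_smul, hz j, smul_eq_mul, smul_eq_mul]; ring

theorem mem_slopeGraph {m : ℕ+ → ℝ} {z : Double X} :
    z ∈ slopeGraph f p m ↔ ∀ j, modeY f p j z = m j * modeX f p j z := Iff.rfl

theorem exists_single_mode (f : HilbertBasis ℕ+ ℝ X) (p : Params) (i : ℕ+) (x y : ℝ) :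
    ∃ z : Double X, ∀ j, modeX f p j z = (if j = i then x else 0) ∧
      modeY f p j z = if j = i then y else 0 := by
  refine exists_modes f p (summable_of_ne_finset_zero (s := {i}) fun j hj => ?_)
  rw [Finset.mem_singleton] at hj
  simp [hj]

/-- In every mode the graph is a line in the plane, and `J` is the rotation by a right angle;
hence the graph is Lagrange. -/
theorem isLagrange_slopeGraph (m : ℕ+ → ℝ) :
    IsLagrange (slopeGraph f p m : Set (Double X)) := by
  refine ⟨slopeGraph f p m, rfl, le_antisymm ?_ fun z hz => ?_⟩
  · rintro _ ⟨z, hz, rfl⟩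
    rw [Submodule.mem_orthogonal]
    intro w hw
    have h := hasSum_mode_mul (f := f) (p := p) w (J z)
    have h0 : ∀ j, modeX f p j w * modeX f p j (J z) + modeY f p j w * modeY f p j (J z) = 0 :=
      fun j => by
        rw [modeX_J, modeY_J, hz j, hw j]; ring
    simp only [h0] at h
    exact h.unique hasSum_zero
  · refine ⟨-J z, fun i => ?_, ?_⟩
    · obtain ⟨w, hw⟩ := exists_single_mode f p i 1 (m i)
      have hwm : w ∈ slopeGraph f p m := fun j => by
        rw [(hw j).1, (hw j).2]
        by_cases hj : j = i <;> simp [hj]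
      have h1 := (Submodule.mem_orthogonal _ _).1 hz w hwm
      have h2 := hasSum_mode_mul (f := f) (p := p) w z
      rw [h1] at h2
      have h3 := h2.unique (hasSum_single i fun j hj => by simp [(hw j).1, (hw j).2, hj])
      simp only [(hw i).1, (hw i).2, if_true, one_mul] at h3
      rw [map_neg, map_neg, modeX_J, modeY_J]
      linarith
    · refine ext_modes (f := f) (p := p) (fun j => ?_) fun j => ?_
      · change modeX f p j (J (-J z)) = _
        rw [modeX_J, map_neg, modeY_J, neg_neg]
      · change modeY f p j (J (-J z)) = _
        rw [modeY_J, map_neg, modeX_J, neg_neg]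

theorem slopeGraph_eq {m : ℕ+ → ℝ} {M : stableSpace f p →L[ℝ] unstableSpace f p}
    (hM : ∀ z j, modeY f p j (M z : Double X) = m j * modeX f p j (z : Double X)) :
    (slopeGraph f p m : Set (Double X)) =
      {z | ∃ zs : stableSpace f p, z = (zs : Double X) + (M zs : Double X)} := by
  ext z
  simp only [SetLike.mem_coe, mem_slopeGraph, Set.mem_ofPred_eq]
  constructor
  · intro hz
    obtain ⟨w, hw⟩ := exists_modes f p (x := fun j => modeX f p j z) (y := fun _ => 0)
      ((hasSum_mode_sq f p z).summable.of_nonneg_of_le (fun j => by positivity) fun j => by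
        nlinarith [sq_nonneg (modeY f p j z)])
    refine ⟨⟨w, mem_stableSpace_iff.2 fun j => (hw j).2⟩, ?_⟩
    refine ext_modes (f := f) (p := p) (fun j => ?_) fun j => ?_
    · rw [map_add, mem_unstableSpace_iff.1 (M _).2, (hw j).1, add_zero]
    · rw [map_add, hM, (hw j).1, (hw j).2, hz j, zero_add]
  · rintro ⟨zs, rfl⟩ j
    rw [map_add, map_add, hM, mem_unstableSpace_iff.1 (M zs).2, mem_stableSpace_iff.1 zs.2,
      zero_add, add_zero]

/-! ### Dichotomy along the solutions of the Riccati equations -/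

/-- The functions `m j` solve the Riccati equations of the system `x' = -K x + b y`,
`y' = -d x + K y`, are bounded by `C`, and the rates `K - b m` are at least `γ > 0`, everything
uniformly in the modes. -/
structure IsSlopeFamily (K : ℕ+ → ℝ → ℝ) (b d : ℕ+ → ℝ) (m : ℕ+ → ℝ → ℝ) (γ C : ℝ) :
    Prop where
  gap_pos : 0 < γ
  continuous_rate : ∀ j, Continuous (K j)
  riccati : ∀ j t, HasDerivAt (m j) (2 * K j t * m j t - d j - b j * m j t ^ 2) t
  gap_le : ∀ j t, γ ≤ K j t - b j * m j t
  abs_le : ∀ j t, |m j t| ≤ C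

namespace IsSlopeFamily

variable {K : ℕ+ → ℝ → ℝ} {b d : ℕ+ → ℝ} {m : ℕ+ → ℝ → ℝ} {γ C : ℝ}
  {z : ℝ → Double X}

theorem nonneg (hs : IsSlopeFamily K b d m γ C) : 0 ≤ C := (abs_nonneg _).trans (hs.abs_le 1 0)

theorem continuous_slope (hs : IsSlopeFamily K b d m γ C) (j : ℕ+) : Continuous (m j) :=
  continuous_iff_continuousAt.2 fun t => (hs.riccati j t).continuousAt

theorem continuous_closed_rate (hs : IsSlopeFamily K b d m γ C) (j : ℕ+) :
    Continuous fun t => K j t - b j * m j t :=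
  (hs.continuous_rate j).sub (continuous_const.mul (hs.continuous_slope j))

theorem mul_le_primitive (hs : IsSlopeFamily K b d m γ C) (j : ℕ+) {t : ℝ} (ht : 0 ≤ t) :
    γ * t ≤ ∫ r in (0 : ℝ)..t, (K j r - b j * m j r) := by
  have h := mul_sub_le_primitive_sub (hs.continuous_closed_rate j) (hs.gap_le j) ht
  simpa using h

/-- The defect `y - m x` of a solution satisfies `w' = (K - b m) w`. -/
theorem defect_eq (hs : IsSlopeFamily K b d m γ C) (hz : IsModeSolution f p K b d z) (j : ℕ+)
    {t : ℝ} (ht : 0 ≤ t) :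
    modeY f p j (z t) - m j t * modeX f p j (z t) =
      (modeY f p j (z 0) - m j 0 * modeX f p j (z 0)) *
        Real.exp (∫ r in (0 : ℝ)..t, (K j r - b j * m j r)) := by
  refine eq_mul_exp_primitive (u := fun t => modeY f p j (z t) - m j t * modeX f p j (z t))
    (hs.continuous_closed_rate j) ?_ (fun t ht => ?_) ht
  · exact ((modeY f p j).continuous.comp_continuousOn hz.1).sub
      ((hs.continuous_slope j).continuousOn.mul ((modeX f p j).continuous.comp_continuousOn hz.1))
  · exact ((hz.2 j t ht).2.sub ((hs.riccati j t).mul (hz.2 j t ht).1)).congr_deriv (by ring)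

theorem modeY_eq (hs : IsSlopeFamily K b d m γ C)
    (hz : IsModeSolution f p K b d z) (h0 : z 0 ∈ slopeGraph f p fun j => m j 0) (j : ℕ+) {t : ℝ}
    (ht : 0 ≤ t) : modeY f p j (z t) = m j t * modeX f p j (z t) := by
  have h := hs.defect_eq hz j ht
  rw [h0 j, sub_self, zero_mul] at h
  linarith

/-- A solution that starts on the graph stays on the moving graph, where the stable coordinates
satisfy `x' = -(K - b m) x`. -/
theorem modeX_eq (hs : IsSlopeFamily K b d m γ C)
    (hz : IsModeSolution f p K b d z) (h0 : z 0 ∈ slopeGraph f p fun j => m j 0) (j : ℕ+) {t : ℝ}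
    (ht : 0 ≤ t) : modeX f p j (z t) = modeX f p j (z 0) *
      Real.exp (-∫ r in (0 : ℝ)..t, (K j r - b j * m j r)) := by
  have h := eq_mul_exp_primitive (u := fun t => modeX f p j (z t))
    (k := fun t => -(K j t - b j * m j t)) (hs.continuous_closed_rate j).neg
    ((modeX f p j).continuous.comp_continuousOn hz.1) (fun t ht => by
      refine (hz.2 j t ht).1.congr_deriv ?_
      rw [hs.modeY_eq hz h0 j ht.le]; ring) ht
  simpa only [intervalIntegral.integral_neg] using h

/-- The curve `(x E, m x E)` with `E = exp (-∫ (K - b m))` decays at the rate `γ`. -/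
theorem sq_exp_le (hs : IsSlopeFamily K b d m γ C) (j : ℕ+) (x : ℝ) {t : ℝ} (ht : 0 ≤ t) :
    (x * Real.exp (-∫ r in (0 : ℝ)..t, (K j r - b j * m j r))) ^ 2 +
      (m j t * (x * Real.exp (-∫ r in (0 : ℝ)..t, (K j r - b j * m j r)))) ^ 2 ≤
      ((1 + C) * Real.exp (-γ * t)) ^ 2 * x ^ 2 := by
  have h1 : Real.exp (-∫ r in (0 : ℝ)..t, (K j r - b j * m j r)) ^ 2 ≤ Real.exp (-γ * t) ^ 2 := by
    refine pow_le_pow_left₀ (Real.exp_pos _).le (Real.exp_le_exp.2 ?_) 2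
    linarith [hs.mul_le_primitive j ht]
  have h2 : 1 + m j t ^ 2 ≤ (1 + C) ^ 2 := by
    have h3 : m j t ^ 2 ≤ C ^ 2 :=
      sq_le_sq' (_root_.abs_le.1 (hs.abs_le j t)).1 (_root_.abs_le.1 (hs.abs_le j t)).2
    nlinarith [hs.nonneg]
  have h3 := mul_le_mul_of_nonneg_right (mul_le_mul h2 h1 (sq_nonneg _) (sq_nonneg _))
    (sq_nonneg x)
  calc _ = (1 + m j t ^ 2) * Real.exp (-∫ r in (0 : ℝ)..t, (K j r - b j * m j r)) ^ 2 * x ^ 2 := by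
        ring
    _ ≤ _ := h3.trans (le_of_eq (by ring))

theorem norm_le (hs : IsSlopeFamily K b d m γ C)
    (hz : IsModeSolution f p K b d z) (h0 : z 0 ∈ slopeGraph f p fun j => m j 0) {t : ℝ}
    (ht : 0 ≤ t) : ‖z t‖ ≤ (1 + C) * Real.exp (-γ * t) * ‖z 0‖ := by
  have hC := hs.nonneg
  refine norm_le_of_mode_sq_le (f := f) (p := p) (by positivity) fun j => ?_
  rw [hs.modeY_eq hz h0 j ht, hs.modeX_eq hz h0 j ht]
  refine (hs.sq_exp_le j _ ht).trans (mul_le_mul_of_nonneg_left ?_ (sq_nonneg _))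
  exact le_add_of_nonneg_right (sq_nonneg _)

/-- A solution that does not start on the graph grows at least like `exp (γ t)`, because its defect
does. -/
theorem exists_exp_le_norm (hs : IsSlopeFamily K b d m γ C)
    (hz : IsModeSolution f p K b d z) (h0 : z 0 ∉ slopeGraph f p fun j => m j 0) :
    ∃ c : ℝ, 0 < c ∧ ∀ t, 0 ≤ t → c * Real.exp (γ * t) ≤ ‖z t‖ := by
  simp only [mem_slopeGraph, not_forall] at h0
  obtain ⟨j, hj⟩ := h0
  have hC := hs.nonneg
  have hw : 0 < |modeY f p j (z 0) - m j 0 * modeX f p j (z 0)| := abs_pos.2 (sub_ne_zero.2 hj)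
  refine ⟨|modeY f p j (z 0) - m j 0 * modeX f p j (z 0)| / (1 + C), by positivity,
    fun t ht => ?_⟩
  have h1 : |modeY f p j (z t) - m j t * modeX f p j (z t)| ≤ (1 + C) * ‖z t‖ := by
    refine (norm_sub_le (modeY f p j (z t)) _).trans ?_
    rw [Real.norm_eq_abs, Real.norm_eq_abs, abs_mul]
    have h2 := mul_le_mul (hs.abs_le j t) (abs_modeX_le (f := f) (p := p) j (z t))
      (abs_nonneg _) hC
    linarith [abs_modeY_le (f := f) (p := p) j (z t)]
  rw [hs.defect_eq hz j ht, abs_mul, Real.abs_exp] at h1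
  have h3 := mul_le_mul_of_nonneg_left (Real.exp_le_exp.2 (hs.mul_le_primitive j ht)) hw.le
  rw [div_mul_eq_mul_div, div_le_iff₀ (by positivity)]
  linarith

/-- A solution through a given point of the graph is obtained by solving `x' = -(K - b m) x` in
every mode and setting `y = m x`. -/
theorem exists_solution (hs : IsSlopeFamily K b d m γ C) {z₀ : Double X}
    (h0 : z₀ ∈ slopeGraph f p fun j => m j 0) :
    ∃ z : ℝ → Double X, IsModeSolution f p K b d z ∧ z 0 = z₀ := by
  have hC := hs.nonneg
  set E : ℕ+ → ℝ → ℝ := fun j t => Real.exp (-∫ r in (0 : ℝ)..t, (K j r - b j * m j r)) with hE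
  have hEc : ∀ j, Continuous (E j) := fun j =>
    (continuous_primitive (hs.continuous_closed_rate j)).neg.rexp
  -- The solution is extended to negative times by a constant, so that one majorant serves all
  -- times.
  set x : ℕ+ → ℝ → ℝ := fun j t => modeX f p j z₀ * E j (max t 0) with hx
  set y : ℕ+ → ℝ → ℝ := fun j t => m j (max t 0) * x j t with hy
  have hbound : ∀ t j, x j t ^ 2 + y j t ^ 2 ≤
      (1 + C) ^ 2 * (modeX f p j z₀ ^ 2 + modeY f p j z₀ ^ 2) := fun t j => by
    refine (hs.sq_exp_le j (modeX f p j z₀) (le_max_right t 0)).trans ?_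
    refine mul_le_mul ?_ (le_add_of_nonneg_right (sq_nonneg _)) (sq_nonneg _) (by positivity)
    refine pow_le_pow_left₀ (by positivity) ?_ 2
    refine mul_le_of_le_one_right (by positivity) (Real.exp_le_one_iff.2 ?_)
    have := mul_nonneg hs.gap_pos.le (le_max_right t 0)
    linarith
  have hsum : Summable fun j => (1 + C) ^ 2 * (modeX f p j z₀ ^ 2 + modeY f p j z₀ ^ 2) :=
    (hasSum_mode_sq f p z₀).summable.mul_left _
  choose z hz using fun t => exists_modes f p (x := fun j => x j t) (y := fun j => y j t)
    (hsum.of_nonneg_of_le (fun j => by positivity) (hbound t))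
  have hxc : ∀ j, Continuous (x j) := fun j =>
    continuous_const.mul ((hEc j).comp (continuous_id.max continuous_const))
  have hyc : ∀ j, Continuous (y j) := fun j =>
    ((hs.continuous_slope j).comp (continuous_id.max continuous_const)).mul (hxc j)
  have hzc : Continuous z := continuous_iff_continuousAt.2 fun t => by
    refine tendsto_of_modes (f := f) (p := p) (fun j => ?_) (fun j => ?_) hsum
      (fun s j => ?_) (fun j => ?_)
    · simp only [(hz _ j).1]; exact (hxc j).continuousAt
    · simp only [(hz _ j).2]; exact (hyc j).continuousAt
    · rw [(hz s j).1, (hz s j).2]; exact hbound s j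
    · rw [(hz t j).1, (hz t j).2]; exact hbound t j
  refine ⟨z, ⟨hzc.continuousOn, fun j t ht => ?_⟩, ?_⟩
  · have hmax : ∀ᶠ s in nhds t, max s 0 = s := by
      filter_upwards [Ioi_mem_nhds ht] with s hs
      exact max_eq_left (le_of_lt hs)
    have hxd : HasDerivAt (x j) (-(K j t - b j * m j t) * x j t) t := by
      have h1 := ((hasDerivAt_primitive (hs.continuous_closed_rate j) t).neg.exp).const_mul
        (modeX f p j z₀)
      refine (h1.congr_deriv ?_).congr_of_eventuallyEq (hmax.mono fun s hs => ?_)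
      · simp only [hx, hE, max_eq_left ht.le, Pi.neg_apply]; ring
      · simp only [hx, hE, hs]
        rfl
    have hyd : HasDerivAt (y j) ((2 * K j t * m j t - d j - b j * m j t ^ 2) * x j t +
        m j t * (-(K j t - b j * m j t) * x j t)) t := by
      refine ((hs.riccati j t).mul hxd).congr_of_eventuallyEq (hmax.mono fun s hs => ?_)
      simp only [hy, hs]
      rfl
    have hyt : y j t = m j t * x j t := by simp only [hy, max_eq_left ht.le]
    simp only [(hz _ j).1, (hz _ j).2]
    refine ⟨hxd.congr_deriv ?_, hyd.congr_deriv ?_⟩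
    · rw [hyt]; ring
    · rw [hyt]; ring
  · refine ext_modes (f := f) (p := p) (fun j => ?_) fun j => ?_
    · rw [(hz 0 j).1]; simp [hx, hE]
    · rw [(hz 0 j).2, h0 j]; simp [hx, hy, hE]

theorem bounded_iff (hs : IsSlopeFamily K b d m γ C) (hz : IsModeSolution f p K b d z) :
    (∃ D : ℝ, ∀ t, 0 ≤ t → ‖z t‖ ≤ D) ↔ z 0 ∈ slopeGraph f p fun j => m j 0 := by
  have hC := hs.nonneg
  constructor
  · rintro ⟨D, hD⟩
    by_contra h0
    obtain ⟨c, hc, h⟩ := hs.exists_exp_le_norm hz h0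
    have hD0 : 0 ≤ D := (norm_nonneg _).trans (hD 0 le_rfl)
    have ht : 0 ≤ D / (c * γ) := div_nonneg hD0 (mul_nonneg hc.le hs.gap_pos.le)
    have h1 := (h _ ht).trans (hD _ ht)
    have h2 := mul_le_mul_of_nonneg_left (Real.add_one_le_exp (γ * (D / (c * γ)))) hc.le
    have h3 : c * (γ * (D / (c * γ)) + 1) = D + c := by
      have := hs.gap_pos.ne'
      field_simp
    linarith
  · intro h0
    refine ⟨(1 + C) * ‖z 0‖, fun t ht => (hs.norm_le hz h0 ht).trans ?_⟩
    refine mul_le_mul_of_nonneg_right (mul_le_of_le_one_right (by positivity) ?_) (norm_nonneg _)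
    refine Real.exp_le_one_iff.2 ?_
    have := mul_nonneg hs.gap_pos.le ht
    linarith

theorem memLp_iff (hs : IsSlopeFamily K b d m γ C) (hz : IsModeSolution f p K b d z) {ε : ℝ}
    (hε : |ε| ≤ γ / 2) :
    MemLp (fun t => Real.exp (ε * t) • z t) 2 (volume.restrict (Set.Ioi (0 : ℝ))) ↔
      z 0 ∈ slopeGraph f p fun j => m j 0 := by
  have hC := hs.nonneg
  have hγ := hs.gap_pos
  have hε' := _root_.abs_le.1 hε
  constructor
  · intro h
    by_contra h0
    -- Off the graph the weighted solution stays away from zero, on a set of infinite measure.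
    obtain ⟨c, hc, hcz⟩ := hs.exists_exp_le_norm hz h0
    have h1 : MemLp (fun _ : ℝ => c) 2 (volume.restrict (Set.Ioi (0 : ℝ))) := by
      refine h.mono aestronglyMeasurable_const
        ((ae_restrict_iff' measurableSet_Ioi).2 (Filter.Eventually.of_forall fun t ht => ?_))
      have ht' : 0 ≤ t := le_of_lt ht
      rw [norm_smul, Real.norm_of_nonneg hc.le, Real.norm_eq_abs, Real.abs_exp]
      have h2 : 1 ≤ Real.exp (ε * t) * Real.exp (γ * t) := by
        rw [← Real.exp_add, ← add_mul]
        exact Real.one_le_exp (mul_nonneg (by linarith) ht')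
      have h3 := mul_le_mul_of_nonneg_left (hcz t ht') (Real.exp_pos (ε * t)).le
      nlinarith
    rw [memLp_const_iff (by norm_num) (by norm_num)] at h1
    simp [hc.ne'] at h1
  · intro h0
    have h1 : MemLp (fun t : ℝ => (1 + C) * ‖z 0‖ * Real.exp (-(γ / 2) * t)) 2
        (volume.restrict (Set.Ioi (0 : ℝ))) := by
      refine MemLp.const_mul ?_ _
      rw [memLp_two_iff_integrable_sq (by fun_prop)]
      have h2 := integrableOn_exp_mul_Ioi (neg_neg_of_pos hγ) 0
      refine IntegrableOn.congr_fun h2 (fun t _ => ?_) measurableSet_Ioi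
      simp only [sq, ← Real.exp_add]
      ring_nf
    refine h1.mono ?_ ((ae_restrict_iff' measurableSet_Ioi).2
      (Filter.Eventually.of_forall fun t ht => ?_))
    · refine ContinuousOn.aestronglyMeasurable ?_ measurableSet_Ioi
      exact ContinuousOn.smul (f := fun t => Real.exp (ε * t)) (by fun_prop)
        (hz.1.mono Set.Ioi_subset_Ici_self)
    · have ht' : 0 ≤ t := le_of_lt ht
      rw [norm_smul, Real.norm_eq_abs, Real.abs_exp, Real.norm_of_nonneg (by positivity)]
      have h2 := mul_le_mul_of_nonneg_left (hs.norm_le hz h0 ht') (Real.exp_pos (ε * t)).le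
      have h3 : Real.exp (ε * t) * Real.exp (-γ * t) ≤ Real.exp (-(γ / 2) * t) := by
        rw [← Real.exp_add, ← add_mul]
        exact Real.exp_le_exp.2 (mul_le_mul_of_nonneg_right (by linarith) ht')
      have h4 := mul_le_mul_of_nonneg_left h3 (show 0 ≤ (1 + C) * ‖z 0‖ by positivity)
      linarith

end IsSlopeFamily

end Fibre

/-! ### Uniform hyperbolicity of the modes -/

section Hyperbolicity

variable {lam : ℕ+ → ℝ} {p : Params}

/-- The positive root `r` of `rateB * r ^ 2 = rateD`, an upper bound for the slope of the
mode `j`. -/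
def slopeBound (lam : ℕ+ → ℝ) (p : Params) (j : ℕ+) : ℝ :=
  Real.sqrt (rateD lam p j / rateB lam p j)

theorem modeB_pos (hτ₂ : 0 < p.τ₂) (j : ℕ+) : 0 < modeB lam p j := by
  unfold modeB; split_ifs <;> positivity

theorem modeD_pos (hΛ : 0 < p.Λ) (hδ : 0 < p.δ) (hτ₂ : 0 < p.τ₂) (j : ℕ+) :
    0 < modeD lam p j := by
  unfold modeD; split_ifs <;> positivity

theorem rateB_pos (hΛ : 0 < p.Λ) (hδ : 0 < p.δ) (hτ₂ : 0 < p.τ₂) (j : ℕ+) :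
    0 < rateB lam p j := by
  unfold rateB; split_ifs
  exacts [modeB_pos hτ₂ j, modeD_pos hΛ hδ hτ₂ j]

theorem rateD_pos (hΛ : 0 < p.Λ) (hδ : 0 < p.δ) (hτ₂ : 0 < p.τ₂) (j : ℕ+) :
    0 < rateD lam p j := by
  unfold rateD; split_ifs
  exacts [modeD_pos hΛ hδ hτ₂ j, modeB_pos hτ₂ j]

theorem rateB_mul_sq_slopeBound (hΛ : 0 < p.Λ) (hδ : 0 < p.δ) (hτ₂ : 0 < p.τ₂) (j : ℕ+) :
    rateB lam p j * slopeBound lam p j ^ 2 = rateD lam p j := by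
  have hb := rateB_pos (lam := lam) hΛ hδ hτ₂ j
  have hd := rateD_pos (lam := lam) hΛ hδ hτ₂ j
  rw [slopeBound, Real.sq_sqrt (div_pos hd hb).le]
  field_simp

theorem exists_slopeBound_le (lam : ℕ+ → ℝ) (p : Params) : ∃ C, ∀ j, slopeBound lam p j ≤ C := by
  set b := p.τ₂⁻¹ + 1
  set d := p.δ ^ 2 + p.τ₂ * p.Λ ^ 2
  refine ⟨Real.sqrt (p.Λ ^ 2 / b) + Real.sqrt (d / 2) + Real.sqrt (b / p.Λ ^ 2) +
    Real.sqrt (2 / d), fun j => ?_⟩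
  have h1 := Real.sqrt_nonneg (p.Λ ^ 2 / b)
  have h2 := Real.sqrt_nonneg (d / 2)
  have h3 := Real.sqrt_nonneg (b / p.Λ ^ 2)
  have h4 := Real.sqrt_nonneg (2 / d)
  unfold slopeBound rateD rateB modeB modeD
  split_ifs <;> linarith

theorem abs_rate_sub_le (c c' : ℝ) (j : ℕ+) :
    |rate lam p c j - rate lam p c' j| ≤ |c - c'| := by
  unfold rate modeShift
  split_ifs
  · simp
  · simp
  · rw [abs_sub_comm c c']; simp
  · simp

/-- The two inequalities of the spatial averaging method give a gap in every mode: the first one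
on the intermediate modes, the second one on the others. The constant `1 / 20` leaves room for
`9 / 10 ≤ (1 - 1 / 20) ^ 2` on the intermediate modes. -/
theorem modeB_mul_modeD_le (hmono : Monotone lam) (hΛ : 0 < p.Λ) (hδ : 0 < p.δ)
    (hμ : 0 < p.μ lam) (hτ₂ : p.τ₂ = (1 / 4) * (p.μ lam / p.Λ) ^ 2)
    (hgap : 5 * p.δ ^ 2 ≤ p.μ lam ^ 2)
    (hk : 0 ≤ ((p.k : ℕ) : ℝ) ^ 2 - 2 * p.Λ * ((p.k : ℕ) : ℝ) - 4 * (p.Λ ^ 4 / (p.μ lam) ^ 2))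
    {c : ℝ} (hc : |c| ≤ p.Λ + p.δ) (j : ℕ+) :
    p.μ lam / 20 ≤ rate lam p c j ∧
      modeB lam p j * modeD lam p j ≤ (rate lam p c j - p.μ lam / 20) ^ 2 := by
  have hc' := abs_le.1 hc
  have hk0 : (0 : ℝ) < ((p.k : ℕ) : ℝ) := by exact_mod_cast p.k.pos
  set κ : ℝ := ((p.k : ℕ) : ℝ) with hκ
  have hα₁ : lam (p.N + 1) - p.α lam = p.μ lam := by simp only [Params.α, Params.μ]; ring
  have hα₂ : p.α lam - lam p.N = p.μ lam := by simp only [Params.α, Params.μ]; ring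
  by_cases ho : Outer lam p j
  · have hrate : p.μ lam + κ - p.Λ - p.δ ≤ rate lam p c j := by
      by_cases hj : p.N < j
      · have h1 : lam p.N ≤ lam j := hmono hj.le
        have h2 : lam (p.N + 1) + κ < lam j := by
          rcases ho with h | h
          · linarith
          · exact h
        simp only [rate, modeShift, hj, ho, if_true]
        linarith
      · have h1 : lam j ≤ lam p.N := hmono (not_lt.1 hj)
        have h2 : lam j < lam p.N - κ := by
          rcases ho with h | h
          · exact h
          · linarith
        simp only [rate, modeShift, hj, ho, if_true, if_false]
        linarith
    have hδμ : 2 * p.δ ≤ p.μ lam := by nlinarith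
    have h4 : 0 ≤ 4 * (p.Λ ^ 4 / p.μ lam ^ 2) := by positivity
    -- The second inequality gives `κ * (κ - 2 * Λ) ≥ 0`.
    have hkΛ : 2 * p.Λ ≤ κ := by nlinarith
    have hbd : modeB lam p j * modeD lam p j = 4 * (p.Λ ^ 4 / p.μ lam ^ 2) + p.Λ ^ 2 := by
      simp only [modeB, modeD, ho, if_true, hτ₂]
      field_simp
    refine ⟨by linarith, ?_⟩
    rw [hbd]
    have h5 : 4 * (p.Λ ^ 4 / p.μ lam ^ 2) + p.Λ ^ 2 ≤ (κ - p.Λ) ^ 2 := by linarith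
    exact h5.trans (pow_le_pow_left₀ (by linarith) (by linarith) 2)
  · have hrate : p.μ lam ≤ rate lam p c j := by
      by_cases hj : p.N < j
      · have h1 : lam (p.N + 1) ≤ lam j := hmono (PNat.add_one_le_iff.2 hj)
        simp only [rate, modeShift, hj, ho, if_true, if_false]
        linarith
      · have h1 : lam j ≤ lam p.N := hmono (not_lt.1 hj)
        simp only [rate, modeShift, hj, ho, if_false]
        linarith
    have hbd : modeB lam p j * modeD lam p j = 2 * (p.δ ^ 2 + p.μ lam ^ 2 / 4) := by
      simp only [modeB, modeD, ho, if_false, hτ₂]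
      field_simp
    refine ⟨by linarith, ?_⟩
    rw [hbd]
    have h5 : (p.μ lam * (19 / 20)) ^ 2 ≤ (rate lam p c j - p.μ lam / 20) ^ 2 :=
      pow_le_pow_left₀ (by positivity) (by linarith) 2
    nlinarith

theorem rateB_mul_slopeBound_add_le (hΛ : 0 < p.Λ) (hδ : 0 < p.δ) (hτ₂ : 0 < p.τ₂) {c γ : ℝ}
    {j : ℕ+} (h : γ ≤ rate lam p c j ∧
      modeB lam p j * modeD lam p j ≤ (rate lam p c j - γ) ^ 2) :
    rateB lam p j * slopeBound lam p j + γ ≤ rate lam p c j := by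
  have h1 : (rateB lam p j * slopeBound lam p j) ^ 2 = modeB lam p j * modeD lam p j := by
    rw [mul_pow, sq (rateB lam p j), mul_assoc, rateB_mul_sq_slopeBound hΛ hδ hτ₂, rateB, rateD]
    split_ifs
    · rfl
    · exact mul_comm _ _
  have h2 := le_of_sq_le_sq (h1.le.trans h.2) (sub_nonneg.2 h.1)
  linarith

end Hyperbolicity

/-! ### Slopes along the orbits of the flow -/

section Orbits

variable {lam : ℕ+ → ℝ} {p : Params} {Q : Type*} [TopologicalSpace Q] {ϑ : Flow ℝ≥0 Q}
  {a : Q → ℝ}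

theorem continuous_orbit (ha : Continuous a) (q : Q) :
    Continuous fun t : ℝ => a (ϑ t.toNNReal q) :=
  ha.comp (ϑ.continuous continuous_real_toNNReal continuous_const)

theorem continuous_rate_orbit (ha : Continuous a) (q : Q) (j : ℕ+) :
    Continuous fun t : ℝ => rate lam p (a (ϑ t.toNNReal q)) j := by
  have h := continuous_orbit (ϑ := ϑ) ha q
  unfold rate modeShift
  split_ifs <;> fun_prop

/-- By dominated convergence, the distance of two orbits seen through `a`, integrated with an
exponentially decaying weight, tends to zero with the distance of the initial points. -/
theorem tendsto_integral_orbit_sub [FirstCountableTopology Q] (ha : Continuous a) {D : ℝ}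
    (hD : ∀ q, |a q| ≤ D) {γ : ℝ} (hγ : 0 < γ) (q : Q) :
    Filter.Tendsto (fun q' => ∫ s in Set.Ioi (0 : ℝ),
      Real.exp (-γ * s) * |a (ϑ s.toNNReal q') - a (ϑ s.toNNReal q)|) (nhds q) (nhds 0) := by
  suffices h : Filter.Tendsto (fun q' => ∫ s in Set.Ioi (0 : ℝ),
      Real.exp (-γ * s) * |a (ϑ s.toNNReal q') - a (ϑ s.toNNReal q)|) (nhds q)
      (nhds (∫ _ in Set.Ioi (0 : ℝ), (0 : ℝ))) by
    rwa [integral_zero] at h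
  refine tendsto_integral_filter_of_dominated_convergence
    (fun s => Real.exp (-γ * s) * (2 * D)) (Filter.Eventually.of_forall fun q' => ?_)
    (Filter.Eventually.of_forall fun q' => Filter.Eventually.of_forall fun s => ?_)
    ((integrableOn_exp_mul_Ioi (neg_neg_of_pos hγ) 0).mul_const _)
    (Filter.Eventually.of_forall fun s => ?_)
  · have h1 := continuous_orbit (ϑ := ϑ) ha q
    have h2 := continuous_orbit (ϑ := ϑ) ha q'
    have h3 : Continuous fun s : ℝ =>
        Real.exp (-γ * s) * |a (ϑ s.toNNReal q') - a (ϑ s.toNNReal q)| := by fun_prop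
    exact h3.aestronglyMeasurable
  · rw [norm_mul, Real.norm_eq_abs, Real.norm_eq_abs, Real.abs_exp, abs_abs]
    refine mul_le_mul_of_nonneg_left ?_ (Real.exp_pos _).le
    have h1 := abs_le.1 (hD (ϑ s.toNNReal q'))
    have h2 := abs_le.1 (hD (ϑ s.toNNReal q))
    exact abs_le.2 ⟨by linarith, by linarith⟩
  · have h1 : Continuous fun q' => a (ϑ s.toNNReal q') :=
      ha.comp (ϑ.continuous continuous_const continuous_id)
    have h2 : Continuous fun q' =>
        Real.exp (-γ * s) * |a (ϑ s.toNNReal q') - a (ϑ s.toNNReal q)| := by fun_prop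
    have h3 := h2.tendsto q
    simpa using h3

variable {X : Type*} [NormedAddCommGroup X] [InnerProductSpace ℝ X] [CompleteSpace X]
  {f : HilbertBasis ℕ+ ℝ X} {m : ℕ+ → ℝ → ℝ} {γ C : ℝ} {q : Q}

theorem boundedFibre_eq (hmono : Monotone lam) (h₁ : p.τ₁ = 1) (h₂ : p.τ₂ ≠ 0)
    (h₃ : p.τ₃ = 1) (ha : Continuous a) {D : ℝ} (hD : ∀ q, |a q| ≤ D)
    (hs : IsSlopeFamily (fun j t => rate lam p (a (ϑ t.toNNReal q)) j) (rateB lam p)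
      (rateD lam p) m γ C) :
    boundedFibre f lam p ϑ a q = slopeGraph f p fun j => m j 0 := by
  ext z₀
  simp only [boundedFibre, isSolution_iff_isModeSolution hmono h₁ h₂ h₃ ha hD,
    Set.mem_ofPred_eq, SetLike.mem_coe]
  constructor
  · rintro ⟨z, hz, rfl, hb⟩
    exact (hs.bounded_iff hz).1 hb
  · intro h0
    obtain ⟨z, hz, rfl⟩ := hs.exists_solution h0
    exact ⟨z, hz, rfl, (hs.bounded_iff hz).2 h0⟩

theorem weightedFibre_eq (hmono : Monotone lam) (h₁ : p.τ₁ = 1) (h₂ : p.τ₂ ≠ 0)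
    (h₃ : p.τ₃ = 1) (ha : Continuous a) {D : ℝ} (hD : ∀ q, |a q| ≤ D)
    (hs : IsSlopeFamily (fun j t => rate lam p (a (ϑ t.toNNReal q)) j) (rateB lam p)
      (rateD lam p) m γ C) {ε : ℝ} (hε : |ε| ≤ γ / 2) :
    weightedFibre f lam p ϑ a ε q = slopeGraph f p fun j => m j 0 := by
  ext z₀
  simp only [weightedFibre, isSolution_iff_isModeSolution hmono h₁ h₂ h₃ ha hD,
    Set.mem_ofPred_eq, SetLike.mem_coe]
  constructor
  · rintro ⟨z, hz, rfl, hb⟩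
    exact (hs.memLp_iff hz hε).1 hb
  · intro h0
    obtain ⟨z, hz, rfl⟩ := hs.exists_solution h0
    exact ⟨z, hz, rfl, (hs.memLp_iff hz hε).2 h0⟩

end Orbits

end

end SpatAvrg

open SpatAvrg in
theorem mainTheorem2 {H : Type*} [NormedAddCommGroup H] [InnerProductSpace ℝ H] [CompleteSpace H]
    (S : SpectralData H)
    {Q : Type*} [MetricSpace Q] [CompleteSpace Q] (ϑ : Flow ℝ≥0 Q)
    (a : Q → ℝ) (ha : Continuous a) (p : Params)
    (hΛ : 0 < p.Λ) (hδ : 0 < p.δ)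
    (hab : ∀ q, |a q| ≤ p.Λ + p.δ)
    (hτ₁ : p.τ₁ = 1)
    (hτ₂ : p.τ₂ = (1 / 4) * (p.μ S.lam / p.Λ) ^ 2)
    (hτ₃ : p.τ₃ = 1)
    (hgap : 0 ≤ p.μ S.lam / Real.sqrt 5 - p.δ)
    (hk : 0 ≤ ((p.k : ℕ) : ℝ) ^ 2 - 2 * p.Λ * ((p.k : ℕ) : ℝ)
      - 4 * (p.Λ ^ 4 / (p.μ S.lam) ^ 2)) :
    (∀ (β : ℝ≥0) (q : Q), IsLagrange (Lb S ϑ a p β q)) ∧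
    (∃ ε₀ : ℝ, 0 < ε₀ ∧
      (∀ (β : ℝ≥0) (q : Q) (ε : ℝ), |ε| ≤ ε₀ → Lb S ϑ a p β q = Lε S ϑ a p ε β q) ∧
      (∀ ε : ℝ, 0 < ε → ε ≤ ε₀ → ∃ M : ℝ, 0 < M ∧
        ∀ (β : ℝ≥0) (q : Q), ∀ z₀ ∈ Lb S ϑ a p β q, ∀ z : ℝ → Double (S.Scale β),
          IsSolution (S.scaleBasis β) S.lam p ϑ a q z → z 0 = z₀ →
            ∀ t : ℝ, 0 ≤ t → ‖z t‖ ≤ M * Real.exp (-ε * t) * ‖z₀‖)) ∧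
    (∃ (M : (β : ℝ≥0) → Q →
          (stableSpace (S.scaleBasis β) p →L[ℝ] unstableSpace (S.scaleBasis β) p)) (C : ℝ),
      (∀ (β : ℝ≥0) (q : Q), Lb S ϑ a p β q =
        {z | ∃ zs : stableSpace (S.scaleBasis β) p,
          z = (zs : Double (S.Scale β)) + (M β q zs : Double (S.Scale β))}) ∧
      (∀ (β : ℝ≥0) (q : Q), ‖M β q‖ ≤ C) ∧
      (∀ β : ℝ≥0, Continuous (M β))) := by
  -- `μ̄ = 0` is excluded by the first inequality, as `δ > 0`.
  have h5 : 0 < Real.sqrt 5 := by positivity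
  have hδμ : p.δ * Real.sqrt 5 ≤ p.μ S.lam := by
    rw [sub_nonneg, le_div_iff₀ h5] at hgap
    exact hgap
  have hμ : 0 < p.μ S.lam := (mul_pos hδ h5).trans_le hδμ
  have hgap' : 5 * p.δ ^ 2 ≤ p.μ S.lam ^ 2 := by
    have h := pow_le_pow_left₀ (mul_pos hδ h5).le hδμ 2
    rw [mul_pow, Real.sq_sqrt (by norm_num)] at h
    linarith
  have hτ₂0 : 0 < p.τ₂ := by rw [hτ₂]; positivity
  have hmono := S.lam_mono
  set γ := p.μ S.lam / 20 with hγdef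
  have hγ : 0 < γ := by positivity
  have hb := rateB_pos (lam := S.lam) hΛ hδ hτ₂0
  have hd := rateD_pos (lam := S.lam) hΛ hδ hτ₂0
  have hbr := rateB_mul_sq_slopeBound (lam := S.lam) hΛ hδ hτ₂0
  have hr : ∀ j, 0 < slopeBound S.lam p j := fun j => Real.sqrt_pos.2 (div_pos (hd j) (hb j))
  obtain ⟨C, hC⟩ := exists_slopeBound_le S.lam p
  have hrate : ∀ (q : Q) (j : ℕ+) (t : ℝ), rateB S.lam p j * slopeBound S.lam p j + γ ≤
      rate S.lam p (a (ϑ t.toNNReal q)) j := fun q j t =>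
    rateB_mul_slopeBound_add_le hΛ hδ hτ₂0
      (modeB_mul_modeD_le hmono hΛ hδ hμ hτ₂ hgap' hk (hab _) j)
  -- The slopes depend on `q` but not on `β`, because the modes have the same equations in all
  -- `H_β`.
  choose m hm hmr using fun (q : Q) (j : ℕ+) =>
    exists_riccati (continuous_rate_orbit (lam := S.lam) (p := p) (ϑ := ϑ) ha q j) (hb j) (hr j)
      hγ (hrate q j)
  have hm_abs : ∀ q j t, |m q j t| ≤ C := fun q j t => by
    rw [abs_of_nonneg (hmr q j t).1]
    exact (hmr q j t).2.trans (hC j)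
  have hs : ∀ q, IsSlopeFamily (fun j t => rate S.lam p (a (ϑ t.toNNReal q)) j) (rateB S.lam p)
      (rateD S.lam p) (m q) γ C := fun q =>
    { gap_pos := hγ
      continuous_rate := fun j => continuous_rate_orbit ha q j
      riccati := fun j t => (hm q j t).congr_deriv (by rw [← hbr j]; ring)
      gap_le := fun j t => by
        have h1 := mul_le_mul_of_nonneg_left (hmr q j t).2 (hb j).le
        have h2 := hrate q j t
        linarith
      abs_le := hm_abs q }
  have hLb : ∀ β q, Lb S ϑ a p β q = slopeGraph (S.scaleBasis β) p fun j => m q j 0 :=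
    fun β q => boundedFibre_eq hmono hτ₁ hτ₂0.ne' hτ₃ ha hab (hs q)
  refine ⟨fun β q => ?_, ⟨γ / 2, by positivity, fun β q ε hε => ?_, fun ε hε hε' => ?_⟩, ?_⟩
  · rw [hLb]
    exact isLagrange_slopeGraph _
  · rw [hLb]
    exact (weightedFibre_eq hmono hτ₁ hτ₂0.ne' hτ₃ ha hab (hs q) hε).symm
  · have hC0 : 0 ≤ C := (hr 1).le.trans (hC 1)
    refine ⟨1 + C, by positivity, fun β q z₀ hz₀ z hz hz0 t ht => ?_⟩
    subst hz0
    rw [hLb] at hz₀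
    have hz' := (isSolution_iff_isModeSolution hmono hτ₁ hτ₂0.ne' hτ₃ ha hab).1 hz
    refine ((hs q).norm_le hz' hz₀ ht).trans ?_
    have h1 : Real.exp (-γ * t) ≤ Real.exp (-ε * t) :=
      Real.exp_le_exp.2 (mul_le_mul_of_nonneg_right (by linarith) ht)
    gcongr
  · choose M hM using fun (β : ℝ≥0) (q : Q) =>
      exists_slopeOp (S.scaleBasis β) p fun j => hm_abs q j 0
    refine ⟨M, C, fun β q => ?_, fun β q => ?_, fun β => ?_⟩
    · rw [hLb]
      exact slopeGraph_eq (hM β q)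
    · exact norm_le_of_slopes (hM β q) fun j => hm_abs q j 0
    · refine continuous_iff_continuousAt.2 fun q => ?_
      refine (tendsto_iff_norm_sub_tendsto_zero
        (E := stableSpace (S.scaleBasis β) p →L[ℝ] unstableSpace (S.scaleBasis β) p)).2 ?_
      have hlim := (tendsto_integral_orbit_sub (ϑ := ϑ) ha hab
        (show 0 < 2 * γ by positivity) q).const_mul (2 * C)
      rw [mul_zero] at hlim
      refine squeeze_zero (fun q' => (M β q' - M β q).opNorm_nonneg) (fun q' => ?_) hlim
      refine norm_le_of_slopes (m := fun j => m q' j 0 - m q j 0) (fun z j => ?_) fun j => ?_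
      · have h1 := hM β q' z j
        have h2 := hM β q z j
        rw [sub_mul, ← h1, ← h2, ← map_sub]
        rfl
      · have hcont : Continuous fun t : ℝ => a (ϑ t.toNNReal q') - a (ϑ t.toNNReal q) :=
          (continuous_orbit ha q').sub (continuous_orbit ha q)
        have h1 := abs_riccati_sub_le
          (continuous_rate_orbit (lam := S.lam) (p := p) (ϑ := ϑ) ha q' j)
          (continuous_rate_orbit ha q j) (hb j) hγ (hrate q' j) (hm q' j) (hm q j) (hmr q' j)
          (hmr q j) hcont (fun t => abs_rate_sub_le _ _ j) (C := 2 * (p.Λ + p.δ)) fun t => by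
            have h2 := abs_le.1 (hab (ϑ t.toNNReal q'))
            have h3 := abs_le.1 (hab (ϑ t.toNNReal q))
            exact abs_le.2 ⟨by linarith, by linarith⟩
        refine h1.trans (mul_le_mul_of_nonneg_right (by linarith [hC j]) ?_)
        exact integral_nonneg fun s => mul_nonneg (Real.exp_pos _).le (abs_nonneg _)
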